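/- A Buffon machine has a finite control with a designated start state, and a finite set of registers, initially empty. In each control state it either halts with an output bit in $\{0,1\}$ or executes one instruction, whose result selects the next control state. The instructions are: toss a fair coin; call the input, a generator of independent Bernoulli variables of parameter $x$ (unknown to the machine); or operate on a register. The registers are integer counters (add $1$, subtract $1$, test for $0$), stacks over $\{0,1\}$ (push, pop, recognizing the empty stack), string registers (a finite binary word with a cursor: rewind, advance, read, write or append at the cursor, erase from the cursor to the end), and bags. A bag holds the lazily generated binary digits $\upsilon_1,\upsilon_2,\dots$ of a number $U=\sum_{j\ge1}\upsilon_j2^{-j}$ uniform on $[0,1]$. A query of the bag tosses the fair coin until $1$ appears, say at toss number $J$, and returns $\upsilon_J$, which is first generated by one more toss of the fair coin if it has not been generated before. A bag can also be emptied, so that it starts afresh. A function $\phi:[0,1)\to[0,1]$ is strongly realizable by a machine $\mathcal M$ if, for every $x\in[0,1)$, $\mathcal M$ with an input generator of parameter $x$ halts with probability $1$, its output is $1$ with probability $\phi(x)$ and $0$ with probability $1-\phi(x)$, and the total number $C$ of coin tosses (fair coin, including those made by the bags, and calls of the input generator together) has exponential tails: there are $K$ and $\rho\in[0,1)$, which may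 depend on $x$, such that $\mathbb P(C>m)\le K\rho^m$ for all $m\ge0$. The machine $\mathcal M$ does not depend on $x$. Theorem. The following functions of $x$, $0\le x<1$, are strongly realizable: $$\log(1+x),\qquad \arctan x,\qquad \tfrac12\arcsin x,\qquad \int_0^x e^{-w^2/2}\,dw.$$ The first two are strongly realizable by machines whose only register is one bag, the third by a machine whose only registers are one bag and one stack, and the fourth by a machine whose only registers are one string register and one bag. -/

import Mathlib

noncomputable section

namespace Buffon

/-- The register set of a machine: how many integer counters, stacks, string registers
and (geometric) bags it owns. -/
structure Registers where
  numCounters : ℕ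
  numStacks : ℕ
  numStrings : ℕ
  numBags : ℕ

/-- A string register: a finite binary word `left ++ right` with a cursor that stands at the
beginning of `right`. The empty register is `⟨[], []⟩`. -/
structure StringReg where
  left : List Bool
  right : List Bool

namespace StringReg

/-- Bring the cursor back to the beginning of the word. -/
def rewind (w : StringReg) : StringReg := ⟨[], w.left ++ w.right⟩

/-- Move the cursor one letter to the right (no effect at the end of the word). -/
def advance (w : StringReg) : StringReg :=
  match w.right with
  | [] => w
  | a :: l => ⟨w.left ++ [a], l⟩

/-- The letter under the cursor, `none` at the end of the word. -/
def read (w : StringReg) : Option Bool := w.right.head?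

/-- Overwrite the letter under the cursor; at the end of the word, append a letter. -/
def write (w : StringReg) (a : Bool) : StringReg := ⟨w.left, a :: w.right.tail⟩

/-- Erase everything from the cursor to the end of the word. -/
def erase (w : StringReg) : StringReg := ⟨w.left, []⟩

end StringReg

/-- A geometric bag, the lazily generated binary expansion of one uniform `U ∈ [0,1]`:
`bits j` is the bit of weight `2 ^ (-(j + 1))` of `U`, or `none` as long as that bit has not
been generated; `ptr` is the index that is being drawn. -/
structure Bag where
  bits : ℕ → Option Bool
  ptr : ℕ

/-- The bag with no bit generated yet. -/
def Bag.empty : Bag := ⟨fun _ => none, 0⟩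

/-- The instructions of a machine with registers `R` and control states `Q`. Each names the
next control state, as a function of the result if it has one. -/
inductive Instr (R : Registers) (Q : Type) : Type
  /-- Halt with output `b`. -/
  | halt (b : Bool)
  /-- Toss the fair coin. -/
  | flip (q : Bool → Q)
  /-- Call the Bernoulli generator on the input. -/
  | input (q : Bool → Q)
  /-- Add one to a counter. -/
  | incr (c : Fin R.numCounters) (q : Q)
  /-- Subtract one from a counter. -/
  | decr (c : Fin R.numCounters) (q : Q)
  /-- Test whether a counter is zero. -/
  | isZero (c : Fin R.numCounters) (q : Bool → Q)
  /-- Push a letter on a stack. -/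
  | push (s : Fin R.numStacks) (a : Bool) (q : Q)
  /-- Pop the top of a stack; the result is `none` if the stack is empty. -/
  | pop (s : Fin R.numStacks) (q : Option Bool → Q)
  /-- Rewind a string register. -/
  | rewind (w : Fin R.numStrings) (q : Q)
  /-- Advance the cursor of a string register. -/
  | advance (w : Fin R.numStrings) (q : Q)
  /-- Read the letter under the cursor of a string register. -/
  | read (w : Fin R.numStrings) (q : Option Bool → Q)
  /-- Write a letter at the cursor of a string register. -/
  | write (w : Fin R.numStrings) (a : Bool) (q : Q)
  /-- Erase a string register from the cursor on. -/
  | erase (w : Fin R.numStrings) (q : Q)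
  /-- Empty a bag. -/
  | newBag (b : Fin R.numBags) (q : Q)
  /-- Query a bag: fetch its bit of index `J`, where `P(J = j) = 2 ^ (-(j + 1))`, `j ≥ 0`. -/
  | bag (b : Fin R.numBags) (q : Bool → Q)

/-- A machine with registers `R`: a finite set of control states, each with its instruction. -/
structure Machine (R : Registers) where
  State : Type
  finite : Finite State
  start : State
  code : State → Instr R State

variable {R : Registers}

/-- A configuration of the machine `M`: the control state, the contents of the registers, the
number `flips` of tosses of the fair coin and the number `calls` of calls of the input
generator that were made so far. -/
structure Config (M : Machine R) where
  state : M.State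
  counter : Fin R.numCounters → ℤ
  stack : Fin R.numStacks → List Bool
  str : Fin R.numStrings → StringReg
  bag : Fin R.numBags → Bag
  flips : ℕ
  calls : ℕ

/-- The initial configuration: all registers are empty. -/
def Config.init (M : Machine R) : Config M where
  state := M.start
  counter := fun _ => 0
  stack := fun _ => []
  str := fun _ => ⟨[], []⟩
  bag := fun _ => Bag.empty
  flips := 0
  calls := 0

/-- The output of a configuration: `some b` if the machine has halted with output `b`. -/
def Config.output {M : Machine R} (c : Config M) : Option Bool :=
  match M.code c.state with
  | .halt b => some b
  | _ => none

/-- The Bernoulli distribution on `{0, 1}` with `P(1) = p`. -/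
def ber (p : NNReal) (hp : p ≤ 1) : PMF Bool :=
  PMF.ofFintype (fun b => if b then (p : ENNReal) else 1 - (p : ENNReal)) (by
    simpa using add_tsub_cancel_of_le (ENNReal.coe_le_one_iff.2 hp))

/-- The fair coin. -/
def coin : PMF Bool := ber (1 / 2) (by norm_num)

/-- One step of the machine `M` on the input generator `X`, every coin toss being independent
of the past. A bag query takes several steps: the index is drawn first, in unary, by tossing
the fair coin until `1` shows up; then the bit of that index is generated by one more toss, if
it was not known before, and it is the result of the query. Every toss is counted. -/
def Machine.step (M : Machine R) (X : PMF Bool) (c : Config M) : PMF (Config M) :=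
  match M.code c.state with
  | .halt _ => PMF.pure c
  | .flip q => coin.map fun r => { c with state := q r, flips := c.flips + 1 }
  | .input q => X.map fun r => { c with state := q r, calls := c.calls + 1 }
  | .incr i q => PMF.pure
      { c with state := q, counter := Function.update c.counter i (c.counter i + 1) }
  | .decr i q => PMF.pure
      { c with state := q, counter := Function.update c.counter i (c.counter i - 1) }
  | .isZero i q => PMF.pure { c with state := q (decide (c.counter i = 0)) }
  | .push i a q => PMF.pure
      { c with state := q, stack := Function.update c.stack i (a :: c.stack i) }
  | .pop i q => PMF.pure
      { c with
        state := q (c.stack i).head?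
        stack := Function.update c.stack i (c.stack i).tail }
  | .rewind i q => PMF.pure
      { c with state := q, str := Function.update c.str i (c.str i).rewind }
  | .advance i q => PMF.pure
      { c with state := q, str := Function.update c.str i (c.str i).advance }
  | .read i q => PMF.pure { c with state := q (c.str i).read }
  | .write i a q => PMF.pure
      { c with state := q, str := Function.update c.str i ((c.str i).write a) }
  | .erase i q => PMF.pure
      { c with state := q, str := Function.update c.str i (c.str i).erase }
  | .newBag i q => PMF.pure
      { c with state := q, bag := Function.update c.bag i Bag.empty }
  | .bag i q =>
      coin.bind fun heads =>
        if heads then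
          match (c.bag i).bits (c.bag i).ptr with
          | some v => PMF.pure
              { c with
                state := q v
                bag := Function.update c.bag i ⟨(c.bag i).bits, 0⟩
                flips := c.flips + 1 }
          | none => coin.map fun v =>
              { c with
                state := q v
                bag := Function.update c.bag i
                  ⟨Function.update (c.bag i).bits (c.bag i).ptr (some v), 0⟩
                flips := c.flips + 2 }
        else PMF.pure
          { c with
            bag := Function.update c.bag i ⟨(c.bag i).bits, (c.bag i).ptr + 1⟩
            flips := c.flips + 1 }

/-- The law of the configuration of `M` after `n` steps, on the input generator `X`. -/
def Machine.run (M : Machine R) (X : PMF Bool) : ℕ → PMF (Config M)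
  | 0 => PMF.pure (Config.init M)
  | n + 1 => (M.run X n).bind (M.step X)

/-- On the input generator `X`, the machine `M` halts with output `b` with probability `p`
(the limit of the probability that it has done so after `n` steps). -/
def Machine.OutputsWithProb (M : Machine R) (X : PMF Bool) (b : Bool) (p : ℝ) : Prop :=
  Filter.Tendsto (fun n => ((M.run X n).toOuterMeasure {c | c.output = some b}).toReal)
    Filter.atTop (nhds p)

/-- On the input generator `X`, the total number `C` of coin tosses that `M` makes, fair flips
and calls of the input generator together, has exponential tails: `P(C > m) ≤ K ρ ^ m` with
`ρ < 1`. The event `C > m` is the increasing union over `n` of the events that more than `m`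
tosses are made in the first `n` steps. -/
def Machine.ExponentialTails (M : Machine R) (X : PMF Bool) : Prop :=
  ∃ K ρ : ℝ, 0 ≤ ρ ∧ ρ < 1 ∧ ∀ m n : ℕ,
    ((M.run X n).toOuterMeasure {c | m < c.flips + c.calls}).toReal ≤ K * ρ ^ m

/-- The function `φ` on `[0,1)` is strongly realizable by a machine with registers `R`: one
and the same machine, given a Bernoulli generator of any (unknown) parameter `x ∈ [0,1)`, halts
with probability one, its output is a Bernoulli variable of parameter `φ x`, and its number of
coin tosses has exponential tails. -/
def StronglyRealizable (R : Registers) (φ : ℝ → ℝ) : Prop :=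
  ∃ M : Machine R, ∀ (x : NNReal) (hx : x < 1),
    M.OutputsWithProb (ber x hx.le) true (φ x) ∧
    M.OutputsWithProb (ber x hx.le) false (1 - φ x) ∧
    M.ExponentialTails (ber x hx.le)

end Buffon

end

/-
Both claims about a machine follow from a function of its configurations that behaves well under
one step.

For the tails, assign to each configuration a bounded potential that decreases in expectation by
at least `1` in each step until the machine halts. Being bounded, it turns this additive drift into
a multiplicative one: as a step makes at most two tosses, `1 +` the potential, weighted by `z ^ C`
with `C` the number of tosses made so far, is a supermartingale for some `z > 1`.

For the output, suppose first that the number `u` in the bag is known: the probability `h s m u`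
of output `1` from the control state `s` with the store `m` is harmonic, because a query succeeds
with probability `u`. Averaging it over the bits of the bag that have not been generated yet yields
a martingale with values in `[0, 1]`, so the mean of `h` over `u` is the probability of output `1`.

The machines perform trials until one fails and look at the parity of the number of successes: if
the trials succeed `k` times or more with probability `p k`, this number is even with probability
`∑ (-1) ^ k * p k`. With `p k = t ^ k` this is `1 / (1 + t)`, and with `p k = l ^ k / k!`, where a
trial succeeds if moreover a new uniform number is less than the one before, it is `exp (-l)`. A
first call of the input supplies a factor `x`, and the integrals arise on averaging over `u`, with
`t = x * u`, `t = (x * u) ^ 2` or `l = (x * u) ^ 2 / 2`. For the arcsine, `x` is replaced by the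
passage probability of a random walk that is killed with probability `1 - x` in each step: the
arctangent of this probability is `arcsin x / 2`.
-/

noncomputable section

namespace Buffon

open MeasureTheory Filter

open scoped ENNReal Topology

variable {R : Registers}

/-- The probability of an event that has probability `a` if a Bernoulli trial of parameter `p`
succeeds, and probability `b` if it fails. -/
def mix (p a b : ℝ) : ℝ := p * a + (1 - p) * b

theorem mix_mem_Icc {p a b : ℝ} (hp : p ∈ Set.Icc 0 1) (ha : a ∈ Set.Icc 0 1)
    (hb : b ∈ Set.Icc 0 1) : mix p a b ∈ Set.Icc 0 1 :=
  convex_Icc 0 1 ha hb hp.1 (sub_nonneg.2 hp.2) (add_sub_cancel p 1)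

theorem mix_nonneg {p a b : ℝ} (hp : p ∈ Set.Icc 0 1) (ha : 0 ≤ a) (hb : 0 ≤ b) :
    0 ≤ mix p a b :=
  convex_Ici (0 : ℝ) ha hb hp.1 (sub_nonneg.2 hp.2) (add_sub_cancel p 1)

theorem mix_mul (s t a b : ℝ) : mix (s * t) a b = mix s (mix t a b) b := by
  unfold mix
  ring

@[fun_prop]
theorem measurable_mix {α : Type*} [MeasurableSpace α] {p a b : α → ℝ} (hp : Measurable p)
    (ha : Measurable a) (hb : Measurable b) : Measurable fun w => mix (p w) (a w) (b w) :=
  (hp.mul ha).add ((measurable_const.sub hp).mul hb)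

/-- The probability of output `1` when a trial of success probability `a` is followed by the
output `1` on success and `0` on failure if `p` is true, and conversely if `p` is false. -/
def orient (p : Bool) (a : ℝ) : ℝ := if p then a else 1 - a

/-- A binary digit as a real number. -/
def digit (b : Bool) : ℝ := if b then 1 else 0

theorem mix_orient (p : Bool) (t a b : ℝ) :
    mix t (orient p a) (orient p b) = orient p (mix t a b) := by
  cases p
  · simp only [orient, mix, Bool.false_eq_true, if_false]
    ring
  · rfl

theorem orient_one (p : Bool) : orient p 1 = digit p := by
  cases p <;> simp [orient, digit]

theorem orient_not (p : Bool) (a : ℝ) : orient (!p) a = orient p (1 - a) := by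
  cases p <;> simp [orient]

theorem mix_digit (b : Bool) (f : Bool → ℝ) : mix (digit b) (f true) (f false) = f b := by
  cases b <;> simp [mix, digit]

theorem orient_mem_Icc (p : Bool) {a : ℝ} (ha : a ∈ Set.Icc 0 1) : orient p a ∈ Set.Icc 0 1 := by
  cases p
  · exact Set.Icc.mem_iff_one_sub_mem.1 ha
  · exact ha

theorem digit_mem_Icc (b : Bool) : digit b ∈ Set.Icc 0 1 := by
  cases b <;> simp [digit]

@[fun_prop]
theorem measurable_orient {α : Type*} [MeasurableSpace α] {a : α → ℝ} (p : Bool)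
    (ha : Measurable a) : Measurable fun w => orient p (a w) := by
  cases p
  · exact measurable_const.sub ha
  · exact ha

/-- The expectation of a nonnegative function under a discrete law. -/
def expect {α : Type*} (p : PMF α) (f : α → ℝ≥0∞) : ℝ≥0∞ := ∑' a, p a * f a

section Expect

variable {α β : Type*}

@[simp]
theorem expect_pure (a : α) (f : α → ℝ≥0∞) : expect (PMF.pure a) f = f a := by
  classical
  simp [expect, PMF.pure_apply]

@[simp]
theorem expect_bind (p : PMF α) (k : α → PMF β) (f : β → ℝ≥0∞) :
    expect (p.bind k) f = expect p fun a => expect (k a) f := by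
  simp only [expect, PMF.bind_apply, ← ENNReal.tsum_mul_right, ← ENNReal.tsum_mul_left]
  rw [ENNReal.tsum_comm]
  simp only [mul_assoc]

@[simp]
theorem expect_map (p : PMF α) (g : α → β) (f : β → ℝ≥0∞) :
    expect (p.map g) f = expect p fun a => f (g a) := by
  simp only [PMF.map, expect_bind, Function.comp_apply, expect_pure]

theorem expect_mono {p : PMF α} {f g : α → ℝ≥0∞} (h : ∀ a ∈ p.support, f a ≤ g a) :
    expect p f ≤ expect p g := by
  refine ENNReal.tsum_le_tsum fun a => ?_
  by_cases ha : p a = 0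
  · simp [ha]
  · gcongr
    exact h a ((PMF.mem_support_iff _ _).2 ha)

theorem expect_congr {p : PMF α} {f g : α → ℝ≥0∞} (h : ∀ a ∈ p.support, f a = g a) :
    expect p f = expect p g :=
  le_antisymm (expect_mono fun a ha => (h a ha).le) (expect_mono fun a ha => (h a ha).ge)

theorem expect_const_mul (p : PMF α) (c : ℝ≥0∞) (f : α → ℝ≥0∞) :
    expect p (fun a => c * f a) = c * expect p f := by
  simp only [expect, ← ENNReal.tsum_mul_left, mul_left_comm]

theorem expect_add (p : PMF α) (f g : α → ℝ≥0∞) :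
    expect p (fun a => f a + g a) = expect p f + expect p g := by
  simp only [expect, mul_add, ENNReal.tsum_add]

@[simp]
theorem expect_const (p : PMF α) (c : ℝ≥0∞) : expect p (fun _ => c) = c := by
  rw [expect, ENNReal.tsum_mul_right, p.tsum_coe, one_mul]

theorem toOuterMeasure_eq_expect (p : PMF α) (s : Set α) :
    p.toOuterMeasure s = expect p (s.indicator 1) := by
  rw [PMF.toOuterMeasure_apply]
  refine tsum_congr fun a => ?_
  by_cases ha : a ∈ s <;> simp [ha]

theorem lintegral_expect [Countable α] [MeasurableSpace β] {μ : Measure β} (p : PMF α)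
    {f : α → β → ℝ≥0∞} (hf : ∀ a, Measurable (f a)) :
    ∫⁻ b, expect p (fun a => f a b) ∂μ = expect p fun a => ∫⁻ b, f a b ∂μ := by
  simp only [expect]
  rw [lintegral_tsum fun a => ((hf a).const_mul _).aemeasurable]
  exact tsum_congr fun a => lintegral_const_mul _ (hf a)

theorem expect_ber_ofReal (x : NNReal) (hx : x ≤ 1) {f : Bool → ℝ} (h : ∀ b, 0 ≤ f b) :
    expect (ber x hx) (fun b => ENNReal.ofReal (f b)) =
      ENNReal.ofReal (mix x (f true) (f false)) := by
  have hx' : (0 : ℝ) ≤ 1 - x := sub_nonneg.2 (by exact_mod_cast hx)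
  rw [expect, tsum_bool, mix, add_comm,
    ENNReal.ofReal_add (mul_nonneg x.coe_nonneg (h _)) (mul_nonneg hx' (h _)),
    ENNReal.ofReal_mul x.coe_nonneg, ENNReal.ofReal_mul hx', ENNReal.ofReal_sub _ x.coe_nonneg]
  simp [ber]

theorem expect_coin_ofReal {f : Bool → ℝ} (h : ∀ b, 0 ≤ f b) :
    expect coin (fun b => ENNReal.ofReal (f b)) =
      ENNReal.ofReal (mix (1 / 2) (f true) (f false)) := by
  simp [coin, expect_ber_ofReal _ _ h]

end Expect

/-- The contents of the registers other than the bags. -/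
structure Store (R : Registers) where
  counter : Fin R.numCounters → ℤ
  stack : Fin R.numStacks → List Bool
  str : Fin R.numStrings → StringReg

/-- The store of the initial configuration. -/
def Store.empty (R : Registers) : Store R := ⟨fun _ => 0, fun _ => [], fun _ => ⟨[], []⟩⟩

/-- What an instruction does, with all deterministic operations on the store as one case. -/
inductive Action (R : Registers) (Q : Type) : Type
  | halt (b : Bool)
  | flip (q : Bool → Q)
  | input (q : Bool → Q)
  | update (f : Store R → Q × Store R)
  | newBag (i : Fin R.numBags) (q : Q)
  | bag (i : Fin R.numBags) (q : Bool → Q)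

/-- The action of an instruction. -/
def Instr.action {Q : Type} : Instr R Q → Action R Q
  | .halt b => .halt b
  | .flip q => .flip q
  | .input q => .input q
  | .incr i q => .update fun m =>
      (q, { m with counter := Function.update m.counter i (m.counter i + 1) })
  | .decr i q => .update fun m =>
      (q, { m with counter := Function.update m.counter i (m.counter i - 1) })
  | .isZero i q => .update fun m => (q (decide (m.counter i = 0)), m)
  | .push i a q => .update fun m =>
      (q, { m with stack := Function.update m.stack i (a :: m.stack i) })
  | .pop i q => .update fun m =>
      (q (m.stack i).head?, { m with stack := Function.update m.stack i (m.stack i).tail })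
  | .rewind i q => .update fun m =>
      (q, { m with str := Function.update m.str i (m.str i).rewind })
  | .advance i q => .update fun m =>
      (q, { m with str := Function.update m.str i (m.str i).advance })
  | .read i q => .update fun m => (q (m.str i).read, m)
  | .write i a q => .update fun m =>
      (q, { m with str := Function.update m.str i ((m.str i).write a) })
  | .erase i q => .update fun m =>
      (q, { m with str := Function.update m.str i (m.str i).erase })
  | .newBag i q => .newBag i q
  | .bag i q => .bag i q

/-- The action of the machine `M` in the control state `s`. -/
def Machine.action (M : Machine R) (s : M.State) : Action R M.State := (M.code s).action

namespace Config

variable {M : Machine R}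

/-- The store of a configuration. -/
def store (c : Config M) : Store R := ⟨c.counter, c.stack, c.str⟩

/-- The configuration `c` with the control state and the store replaced. -/
def move (c : Config M) (p : M.State × Store R) : Config M :=
  { c with state := p.1, counter := p.2.counter, stack := p.2.stack, str := p.2.str }

/-- The configuration `c` after `k` tosses which left the machine in state `s` with the bag `B`
in place of its bag `i`. -/
def setBag (c : Config M) (i : Fin R.numBags) (B : Bag) (k : ℕ) (s : M.State) : Config M :=
  { c with state := s, bag := Function.update c.bag i B, flips := c.flips + k }

@[simp]
theorem setBag_bag_self (c : Config M) (i : Fin R.numBags) (B : Bag) (k : ℕ) (s : M.State) :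
    (c.setBag i B k s).bag i = B := by
  simp [setBag]

theorem output_eq_some_iff {c : Config M} {b : Bool} :
    c.output = some b ↔ M.action c.state = .halt b := by
  unfold output Machine.action
  cases M.code c.state <;> simp [Instr.action]

end Config

theorem Machine.step_eq (M : Machine R) (X : PMF Bool) (c : Config M) :
    M.step X c = match M.action c.state with
      | .halt _ => PMF.pure c
      | .flip q => coin.map fun r => { c with state := q r, flips := c.flips + 1 }
      | .input q => X.map fun r => { c with state := q r, calls := c.calls + 1 }
      | .update f => PMF.pure (c.move (f c.store))
      | .newBag i q => PMF.pure (c.setBag i Bag.empty 0 q)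
      | .bag i q => coin.bind fun heads =>
          if heads then
            match (c.bag i).bits (c.bag i).ptr with
            | some v => PMF.pure (c.setBag i ⟨(c.bag i).bits, 0⟩ 1 (q v))
            | none => coin.map fun v => c.setBag i
                ⟨Function.update (c.bag i).bits (c.bag i).ptr (some v), 0⟩ 2 (q v)
          else PMF.pure (c.setBag i ⟨(c.bag i).bits, (c.bag i).ptr + 1⟩ 1 c.state) := by
  unfold Machine.step Machine.action
  cases M.code c.state <;> rfl

/-- The number of coin tosses made so far. -/
def Config.tosses {M : Machine R} (c : Config M) : ℕ := c.flips + c.calls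

theorem Machine.tosses_step_le {M : Machine R} {X : PMF Bool} {c c' : Config M}
    (h : c' ∈ (M.step X c).support) : c'.tosses ≤ c.tosses + 2 := by
  rw [M.step_eq] at h
  unfold Config.tosses
  cases hc : M.action c.state with rw [hc] at h
  | halt | update | newBag =>
    rw [PMF.support_pure, Set.mem_singleton_iff] at h
    subst h
    exact Nat.le_add_right _ 2
  | flip | input =>
    obtain ⟨r, -, rfl⟩ := (PMF.mem_support_map_iff _ _ _).1 h
    dsimp only
    omega
  | bag i q =>
    obtain ⟨heads, -, h⟩ := (PMF.mem_support_bind_iff _ _ _).1 h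
    split at h
    · split at h
      · rw [PMF.support_pure, Set.mem_singleton_iff] at h
        subst h
        simp only [Config.setBag]
        omega
      · obtain ⟨v, -, rfl⟩ := (PMF.mem_support_map_iff _ _ _).1 h
        simp only [Config.setBag]
        omega
    · rw [PMF.support_pure, Set.mem_singleton_iff] at h
      subst h
      simp only [Config.setBag]
      omega

theorem Machine.step_of_output {M : Machine R} {X : PMF Bool} {c : Config M} {b : Bool}
    (h : c.output = some b) : M.step X c = PMF.pure c := by
  rw [M.step_eq, Config.output_eq_some_iff.1 h]

theorem Machine.expect_run_succ (M : Machine R) (X : PMF Bool) (n : ℕ) (f : Config M → ℝ≥0∞) :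
    expect (M.run X (n + 1)) f = expect (M.run X n) fun c => expect (M.step X c) f :=
  expect_bind _ _ _

section Drift

variable {M : Machine R} {X : PMF Bool}

theorem Machine.pow_mul_expect_run_le {y : ℝ≥0∞} {g : Config M → ℝ≥0∞}
    (h : ∀ c, y * expect (M.step X c) g ≤ g c) (n : ℕ) :
    y ^ n * expect (M.run X n) g ≤ g (Config.init M) := by
  induction n with
  | zero => simp [Machine.run]
  | succ n ih =>
    calc y ^ (n + 1) * expect (M.run X (n + 1)) g
        = y ^ n * expect (M.run X n) fun c => y * expect (M.step X c) g := by
          rw [M.expect_run_succ, expect_const_mul, pow_succ, mul_assoc]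
      _ ≤ y ^ n * expect (M.run X n) g := by
          gcongr
          exact expect_mono fun c _ => h c
      _ ≤ g (Config.init M) := ih

/-- A bounded function of the configuration that decreases by at least `1` on average in each
step before the machine halts (a Foster–Lyapunov function). -/
structure IsFoster (M : Machine R) (X : PMF Bool) (f : Config M → ℝ≥0∞) : Prop where
  drift : ∀ c, c.output = none → expect (M.step X c) f + 1 ≤ f c
  bounded : ∃ B : NNReal, ∀ c, f c ≤ B

/-- Since `f ≤ B`, the additive drift of `f` is a multiplicative one of `1 + f`. -/
theorem IsFoster.exists_one_lt_mul_le {f : Config M → ℝ≥0∞} (hf : IsFoster M X f) :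
    ∃ y : ℝ≥0∞, 1 < y ∧
      ∀ c, c.output = none → y * expect (M.step X c) (fun c' => 1 + f c') ≤ 1 + f c := by
  obtain ⟨B, hB⟩ := hf.bounded
  have hB_top : (1 + B : ℝ≥0∞) ≠ ∞ := by simp
  refine ⟨1 + (1 + B : ℝ≥0∞)⁻¹,
    ENNReal.lt_add_right ENNReal.one_ne_top (ENNReal.inv_ne_zero.2 hB_top), fun c hc => ?_⟩
  have h_ratio : (1 + B : ℝ≥0∞)⁻¹ * f c ≤ 1 :=
    (ENNReal.inv_mul_le_iff (by simp) hB_top).2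
      ((hB c).trans (by rw [mul_one]; exact le_add_self))
  calc (1 + (1 + B : ℝ≥0∞)⁻¹) * expect (M.step X c) (fun c' => 1 + f c')
      ≤ (1 + (1 + B : ℝ≥0∞)⁻¹) * f c := by
        rw [expect_add, expect_const, add_comm 1 (expect _ _)]
        gcongr
        exact hf.drift c hc
    _ = f c + (1 + B : ℝ≥0∞)⁻¹ * f c := by rw [add_mul, one_mul]
    _ ≤ 1 + f c := by
        rw [add_comm]
        gcongr

theorem le_mul_inv_pow {a y K : ℝ≥0∞} {n : ℕ} (hy : 1 < y) (hK : K ≠ ∞) (h : y ^ n * a ≤ K) :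
    a ≤ K * y⁻¹ ^ n := by
  rw [← ENNReal.inv_pow, ← div_eq_mul_inv,
    ENNReal.le_div_iff_mul_le (.inl (pow_ne_zero _ (pos_of_gt hy).ne')) (.inr hK), mul_comm]
  exact h

theorem IsFoster.tendsto_expect_not_halted {f : Config M → ℝ≥0∞} (hf : IsFoster M X f) :
    Tendsto (fun n => expect (M.run X n) ({c | c.output = none}.indicator 1)) atTop (𝓝 0) := by
  obtain ⟨y, hy, hstep⟩ := hf.exists_one_lt_mul_le
  obtain ⟨B, hB⟩ := hf.bounded
  set g : Config M → ℝ≥0∞ := {c | c.output = none}.indicator fun c => 1 + f c with hg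
  have h_drift : ∀ c, y * expect (M.step X c) g ≤ g c := fun c => by
    cases hc : c.output with
    | none =>
      calc y * expect (M.step X c) g ≤ y * expect (M.step X c) (fun c' => 1 + f c') := by
            gcongr
            exact expect_mono fun c' _ => Set.indicator_le_self _ _ c'
        _ ≤ 1 + f c := hstep c hc
        _ = g c := by simp only [hg, Set.indicator, Set.mem_ofPred_eq, hc, if_true]
    | some b =>
      have h_zero : g c = 0 := Set.indicator_of_notMem (by simp [hc]) _
      rw [Machine.step_of_output hc, expect_pure, h_zero, mul_zero]
  have h_top : g (Config.init M) ≠ ∞ :=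
    ne_top_of_le_ne_top (by simp : (1 + B : ℝ≥0∞) ≠ ∞)
      ((Set.indicator_le_self _ _ _).trans (by gcongr; exact hB _))
  have h_geom : Tendsto (fun n => g (Config.init M) * y⁻¹ ^ n) atTop (𝓝 0) := by
    rw [← mul_zero (g (Config.init M))]
    exact ENNReal.Tendsto.const_mul
      (ENNReal.tendsto_pow_atTop_nhds_zero_of_lt_one (ENNReal.inv_lt_one.2 hy)) (.inr h_top)
  refine tendsto_of_tendsto_of_tendsto_of_le_of_le tendsto_const_nhds h_geom
    (fun _ => zero_le) fun n => ?_
  refine (expect_mono fun c _ => ?_).trans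
    (le_mul_inv_pow hy h_top (Machine.pow_mul_expect_run_le h_drift n))
  exact Set.indicator_le_indicator le_self_add

theorem IsFoster.exists_expect_pow_tosses_le {f : Config M → ℝ≥0∞} (hf : IsFoster M X f) :
    ∃ z : ℝ≥0∞, 1 < z ∧ ∃ K : NNReal, ∀ n, expect (M.run X n) (fun c => z ^ c.tosses) ≤ K := by
  obtain ⟨y, hy, hstep⟩ := hf.exists_one_lt_mul_le
  obtain ⟨B, hB⟩ := hf.bounded
  set z : ℝ≥0∞ := y ^ (1 / 2 : ℝ)
  have hz : 1 < z := ENNReal.one_lt_rpow hy one_half_pos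
  have hzy : z ^ 2 = y := by
    rw [← ENNReal.rpow_natCast, ← ENNReal.rpow_mul]
    norm_num
  set g : Config M → ℝ≥0∞ := fun c => z ^ c.tosses * (1 + f c) with hg
  -- A step makes at most two tosses, and its factor `y = z ^ 2` pays for them.
  have h_drift : ∀ c, 1 * expect (M.step X c) g ≤ g c := fun c => by
    rw [one_mul]
    cases hc : c.output with
    | none =>
      calc expect (M.step X c) g
          ≤ expect (M.step X c) fun c' => z ^ (c.tosses + 2) * (1 + f c') :=
            expect_mono fun c' hc' =>
              mul_le_mul_left (pow_le_pow_right₀ hz.le (Machine.tosses_step_le hc')) _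
        _ = z ^ c.tosses * (y * expect (M.step X c) fun c' => 1 + f c') := by
            rw [expect_const_mul, pow_add, hzy, mul_assoc]
        _ ≤ z ^ c.tosses * (1 + f c) := by
            gcongr
            exact hstep c hc
    | some b => rw [Machine.step_of_output hc, expect_pure]
  refine ⟨z, hz, 1 + B, fun n => ?_⟩
  calc expect (M.run X n) (fun c => z ^ c.tosses) ≤ expect (M.run X n) g :=
        expect_mono fun c _ => le_mul_of_one_le_right zero_le le_self_add
    _ ≤ g (Config.init M) := by
        simpa only [one_pow, one_mul] using Machine.pow_mul_expect_run_le h_drift n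
    _ = 1 + f (Config.init M) := by simp [hg, Config.tosses, Config.init]
    _ ≤ (1 + B : NNReal) := by
        push_cast
        gcongr
        exact hB _

theorem IsFoster.exponentialTails {f : Config M → ℝ≥0∞} (hf : IsFoster M X f) :
    M.ExponentialTails X := by
  obtain ⟨z, hz, K, hK⟩ := hf.exists_expect_pow_tosses_le
  have hz_inv : z⁻¹ < 1 := ENNReal.inv_lt_one.2 hz
  refine ⟨K, z⁻¹.toReal, ENNReal.toReal_nonneg, ?_, fun m n => ?_⟩
  · simpa using (ENNReal.toReal_lt_toReal hz_inv.ne_top ENNReal.one_ne_top).2 hz_inv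
  have h_markov : z ^ m * (M.run X n).toOuterMeasure {c | m < c.flips + c.calls} ≤ K := by
    rw [toOuterMeasure_eq_expect, ← expect_const_mul]
    refine (expect_mono fun c _ => ?_).trans (hK n)
    by_cases hc : m < c.flips + c.calls
    · simpa [hc, Config.tosses] using pow_le_pow_right₀ hz.le hc.le
    · simp [hc]
  have h_le := le_mul_inv_pow hz ENNReal.coe_ne_top h_markov
  refine (ENNReal.toReal_mono ?_ h_le).trans_eq (by simp)
  exact ENNReal.mul_ne_top ENNReal.coe_ne_top (ENNReal.pow_ne_top hz_inv.ne_top)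

/-- The drift condition for a potential `d` of the control states, when the input generator has
parameter `x`. The loss of `2` in a bag query pays for the two tosses it takes on average. -/
def Machine.Descends (M : Machine R) (x : ℝ) (d : M.State → ℝ) : Prop :=
  ∀ s, 0 ≤ d s ∧
    match M.action s with
    | .halt _ => True
    | .flip q => mix (1 / 2) (d (q true)) (d (q false)) + 1 ≤ d s
    | .input q => mix x (d (q true)) (d (q false)) + 1 ≤ d s
    | .update f => ∀ m, d (f m).1 + 1 ≤ d s
    | .newBag _ q => d q + 1 ≤ d s
    | .bag _ q => ∀ r, d (q r) + 2 ≤ d s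

theorem ofReal_add_one_le {a b : ℝ} (ha : 0 ≤ a) (hab : a + 1 ≤ b) :
    ENNReal.ofReal a + 1 ≤ ENNReal.ofReal b := by
  rw [← ENNReal.ofReal_one, ← ENNReal.ofReal_add ha zero_le_one]
  exact ENNReal.ofReal_le_ofReal hab

theorem Machine.Descends.expect_step_add_one_le {x : NNReal} (hx : x ≤ 1) {d : M.State → ℝ}
    (hd : M.Descends x d) {c : Config M} (hc : c.output = none) :
    expect (M.step (ber x hx) c) (fun c' => ENNReal.ofReal (d c'.state)) + 1 ≤
      ENNReal.ofReal (d c.state) := by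
  have h_nonneg : ∀ s, 0 ≤ d s := fun s => (hd s).1
  have hs := (hd c.state).2
  rw [M.step_eq]
  cases h_act : M.action c.state with rw [h_act] at hs
  | halt b => simp [Config.output_eq_some_iff.2 h_act] at hc
  | flip q =>
    rw [expect_map, expect_coin_ofReal fun _ => h_nonneg _]
    exact ofReal_add_one_le (mix_nonneg (by norm_num) (h_nonneg _) (h_nonneg _)) hs
  | input q =>
    rw [expect_map, expect_ber_ofReal x hx fun _ => h_nonneg _]
    have hx_mem : (x : ℝ) ∈ Set.Icc 0 1 := ⟨x.coe_nonneg, by exact_mod_cast hx⟩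
    exact ofReal_add_one_le (mix_nonneg hx_mem (h_nonneg _) (h_nonneg _)) hs
  | update f =>
    rw [expect_pure]
    exact ofReal_add_one_le (h_nonneg _) (hs c.store)
  | newBag i q =>
    rw [expect_pure]
    exact ofReal_add_one_le (h_nonneg _) hs
  | bag i q =>
    have h_end : ∀ r, d (q r) ≤ d c.state - 2 := fun r => le_sub_iff_add_le.2 (hs r)
    have h_two : 0 ≤ d c.state - 2 := (h_nonneg _).trans (h_end true)
    rw [expect_bind]
    refine (add_le_add_left (expect_mono (g := fun heads =>
      ENNReal.ofReal (if heads then d c.state - 2 else d c.state)) fun heads _ => ?_) 1).trans ?_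
    · cases heads
      · simp [Config.setBag]
      · simp only [if_true]
        split
        · rw [expect_pure]
          exact ENNReal.ofReal_le_ofReal (h_end _)
        · rw [expect_map, ← expect_const coin (ENNReal.ofReal _)]
          exact expect_mono fun r _ => ENNReal.ofReal_le_ofReal (h_end r)
    · rw [expect_coin_ofReal fun heads => by split_ifs <;> simp only [h_two, h_nonneg]]
      refine ofReal_add_one_le (mix_nonneg (by norm_num) h_two (h_nonneg _)) ?_
      simp only [mix, if_true, Bool.false_eq_true, if_false]
      linarith

theorem Machine.Descends.isFoster {x : NNReal} (hx : x ≤ 1) {d : M.State → ℝ}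
    (hd : M.Descends x d) :
    IsFoster M (ber x hx) fun c => ENNReal.ofReal (d c.state) where
  drift _ := hd.expect_step_add_one_le hx
  bounded := by
    have := M.finite
    obtain ⟨B, hB⟩ := Finite.bddAbove_range d
    exact ⟨B.toNNReal, fun c => ENNReal.ofReal_le_ofReal (hB ⟨c.state, rfl⟩)⟩

end Drift

section Martingale

variable {M : Machine R} {X : PMF Bool}

/-- A function `f` of the configuration that is a bounded martingale along the runs of `M`, all of
which stay in `I`, and that ends with the value `1` or `0` according to the output. -/
structure IsMartingale (M : Machine R) (X : PMF Bool) (I : Set (Config M))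
    (f : Config M → ℝ≥0∞) : Prop where
  init_mem : Config.init M ∈ I
  step_mem : ∀ c ∈ I, ∀ c' ∈ (M.step X c).support, c' ∈ I
  le_one : ∀ c, f c ≤ 1
  expect_step : ∀ c ∈ I, expect (M.step X c) f = f c
  output : ∀ c b, c.output = some b → f c = if b then 1 else 0

variable {I : Set (Config M)} {f : Config M → ℝ≥0∞}

namespace IsMartingale

theorem run_mem (hf : IsMartingale M X I f) (n : ℕ) : ∀ c ∈ (M.run X n).support, c ∈ I := by
  induction n with
  | zero =>
    intro c hc
    rw [Machine.run, PMF.support_pure, Set.mem_singleton_iff] at hc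
    exact hc ▸ hf.init_mem
  | succ n ih =>
    intro c hc
    obtain ⟨c₀, hc₀, h_step⟩ := (PMF.mem_support_bind_iff _ _ _).1 hc
    exact hf.step_mem c₀ (ih c₀ hc₀) c h_step

theorem expect_run (hf : IsMartingale M X I f) (n : ℕ) :
    expect (M.run X n) f = f (Config.init M) := by
  induction n with
  | zero => exact expect_pure _ _
  | succ n ih =>
    rw [M.expect_run_succ, ← ih]
    exact expect_congr fun c hc => hf.expect_step c (hf.run_mem n c hc)

theorem tendsto_output_true (hf : IsMartingale M X I f)
    (h_halt : Tendsto (fun n => expect (M.run X n) ({c | c.output = none}.indicator 1)) atTop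
      (𝓝 0)) :
    Tendsto (fun n => (M.run X n).toOuterMeasure {c | c.output = some true}) atTop
      (𝓝 (f (Config.init M))) := by
  have h_upper : ∀ n, (M.run X n).toOuterMeasure {c | c.output = some true} ≤
      f (Config.init M) := fun n => by
    rw [← hf.expect_run n, toOuterMeasure_eq_expect]
    refine expect_mono fun c _ => Set.indicator_le (fun c hc => ?_) c
    simp [hf.output c true hc]
  have h_lower : ∀ n, f (Config.init M) - expect (M.run X n) ({c | c.output = none}.indicator 1) ≤
      (M.run X n).toOuterMeasure {c | c.output = some true} := fun n => by
    rw [tsub_le_iff_right, ← hf.expect_run n, toOuterMeasure_eq_expect, ← expect_add]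
    refine expect_mono fun c _ => ?_
    rcases h : c.output with _ | _ | _
    · simpa [h] using hf.le_one c
    · simp [hf.output c _ h]
    · simp [hf.output c _ h, h]
  refine tendsto_of_tendsto_of_tendsto_of_le_of_le ?_ tendsto_const_nhds h_lower h_upper
  simpa using ENNReal.Tendsto.sub tendsto_const_nhds h_halt
    (.inl (ne_top_of_le_ne_top ENNReal.one_ne_top (hf.le_one _)))

theorem outputsWithProb (hf : IsMartingale M X I f)
    (h_halt : Tendsto (fun n => expect (M.run X n) ({c | c.output = none}.indicator 1)) atTop
      (𝓝 0)) {p : ℝ} (hp : 0 ≤ p) (h_init : f (Config.init M) = ENNReal.ofReal p) :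
    M.OutputsWithProb X true p ∧ M.OutputsWithProb X false (1 - p) := by
  have h_true := h_init ▸ hf.tendsto_output_true h_halt
  have h_false : ∀ n, (M.run X n).toOuterMeasure {c | c.output = some false} =
      1 - ((M.run X n).toOuterMeasure {c | c.output = some true} +
        expect (M.run X n) ({c | c.output = none}.indicator 1)) := fun n => by
    refine ENNReal.eq_sub_of_add_eq' ENNReal.one_ne_top ?_
    rw [toOuterMeasure_eq_expect, toOuterMeasure_eq_expect, ← expect_add, ← expect_add,
      ← expect_const (M.run X n) 1]
    refine expect_congr fun c _ => ?_
    rcases h : c.output with _ | _ | _ <;> simp [h]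
  constructor
  · rw [← ENNReal.toReal_ofReal hp]
    exact (ENNReal.tendsto_toReal ENNReal.ofReal_ne_top).comp h_true
  · have h_lim : (1 - (ENNReal.ofReal p + 0)).toReal = 1 - p := by
      rw [add_zero, ENNReal.toReal_sub_of_le (h_init ▸ hf.le_one _) ENNReal.one_ne_top,
        ENNReal.toReal_one, ENNReal.toReal_ofReal hp]
    rw [← h_lim]
    simp only [Machine.OutputsWithProb, h_false]
    exact (ENNReal.tendsto_toReal (ENNReal.sub_ne_top ENNReal.one_ne_top)).comp
      (ENNReal.Tendsto.sub tendsto_const_nhds (h_true.add h_halt) (.inl ENNReal.one_ne_top))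

end IsMartingale

end Martingale

/-- The law of a sequence of independent fair bits. -/
def fairBits : Measure (ℕ → Bool) := Measure.infinitePi fun _ => coin.toMeasure

instance : IsProbabilityMeasure fairBits := by
  unfold fairBits
  infer_instance

theorem measurePreserving_update (j : ℕ) :
    MeasurePreserving (fun p : Bool × (ℕ → Bool) => Function.update p.2 j p.1)
      (coin.toMeasure.prod fairBits) fairBits := by
  have h_meas : Measurable fun p : Bool × (ℕ → Bool) => Function.update p.2 j p.1 := by
    refine measurable_pi_lambda _ fun i => ?_
    by_cases h : i = j <;> simp only [Function.update_apply, h, if_true, if_false] <;> fun_prop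
  refine ⟨h_meas, Measure.eq_infinitePi _ fun s t ht => ?_⟩
  have h_box : (fun p : Bool × (ℕ → Bool) => Function.update p.2 j p.1) ⁻¹' Set.pi s t =
      (if j ∈ s then t j else Set.univ) ×ˢ Set.pi (s.erase j) t := by
    ext p
    simp only [Set.mem_preimage, Set.mem_pi, Set.mem_prod, Finset.mem_coe, Finset.mem_erase,
      Function.update_apply]
    grind
  rw [Measure.map_apply h_meas (.pi s.countable_toSet fun i _ => ht i), h_box, Measure.prod_prod,
    fairBits, Measure.infinitePi_pi _ fun i _ => ht i]
  split_ifs with hj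
  · exact Finset.mul_prod_erase s (fun i => coin.toMeasure (t i)) hj
  · rw [measure_univ, one_mul, Finset.erase_eq_of_notMem hj]

theorem measurePreserving_shift :
    MeasurePreserving (fun (ω : ℕ → Bool) i => ω (i + 1)) fairBits fairBits := by
  have h_meas : Measurable fun (ω : ℕ → Bool) i => ω (i + 1) := by fun_prop
  refine ⟨h_meas, Measure.eq_infinitePi _ fun s t ht => ?_⟩
  have h_box : (fun (ω : ℕ → Bool) i => ω (i + 1)) ⁻¹' Set.pi s t =
      Set.pi (s.map (addRightEmbedding 1)) fun i => t (i - 1) := by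
    ext ω
    simp
  rw [Measure.map_apply h_meas (.pi s.countable_toSet fun i _ => ht i), h_box,
    fairBits, Measure.infinitePi_pi _ fun i _ => ht _]
  simp

theorem lintegral_update (j : ℕ) {G : (ℕ → Bool) → ℝ≥0∞} (hG : Measurable G) :
    ∫⁻ ω, G ω ∂fairBits = expect coin fun v => ∫⁻ ω, G (Function.update ω j v) ∂fairBits := by
  have h_upd := measurePreserving_update j
  rw [← h_upd.lintegral_comp hG, lintegral_prod (fun p => G (Function.update p.2 j p.1))
    (hG.comp h_upd.measurable).aemeasurable, lintegral_countable', expect]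
  simp [mul_comm]

theorem integral_update (j : ℕ) {G : (ℕ → Bool) → ℝ} (hG : Integrable G fairBits) :
    ∫ ω, G ω ∂fairBits = mix (1 / 2) (∫ ω, G (Function.update ω j true) ∂fairBits)
      (∫ ω, G (Function.update ω j false) ∂fairBits) := by
  have h_upd := measurePreserving_update j
  conv_lhs => rw [← h_upd.map_eq]
  rw [integral_map h_upd.aemeasurable (h_upd.map_eq.symm ▸ hG.aestronglyMeasurable),
    integral_prod (fun p => G (Function.update p.2 j p.1))
      (h_upd.integrable_comp_of_integrable hG), PMF.integral_eq_sum]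
  norm_num [mix, coin, ber]

/-- The number with binary expansion `0.ω₀ω₁ω₂…`. -/
def binary (ω : ℕ → Bool) : ℝ := Real.ofDigits fun i => bif ω i then (1 : Fin 2) else 0

theorem binary_mem_Icc (ω : ℕ → Bool) : binary ω ∈ Set.Icc 0 1 :=
  ⟨Real.ofDigits_nonneg _, Real.ofDigits_le_one _⟩

theorem continuous_binary : Continuous binary :=
  Real.continuous_ofDigits.comp (continuous_pi fun i =>
    (continuous_of_discreteTopology (f := fun b => bif b then (1 : Fin 2) else 0)).comp
      (continuous_apply i))

theorem binary_eq (ω : ℕ → Bool) : binary ω = (digit (ω 0) + binary fun i => ω (i + 1)) / 2 := by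
  unfold binary
  rw [Real.ofDigits_eq_sum_add_ofDigits _ 1]
  cases h : ω 0 <;> simp [Real.ofDigitsTerm, digit, h] <;> ring

/-- The law `μ` on `[0, 1]` is invariant under appending a fair binary digit in front. -/
structure IsSelfSimilar (μ : Measure ℝ) : Prop where
  ae_mem : ∀ᵐ t ∂μ, t ∈ Set.Icc (0 : ℝ) 1
  integral_eq : ∀ h : BoundedContinuousFunction ℝ ℝ, ∫ t, h t ∂μ =
    mix (1 / 2) (∫ t, h ((digit true + t) / 2) ∂μ) (∫ t, h ((digit false + t) / 2) ∂μ)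

theorem isSelfSimilar_map_binary : IsSelfSimilar (fairBits.map binary) where
  ae_mem := (ae_map_iff continuous_binary.aemeasurable measurableSet_Icc).2
    (.of_forall binary_mem_Icc)
  integral_eq h := by
    have h_map : ∀ g : ℝ → ℝ, Continuous g → ∫ t, g t ∂fairBits.map binary =
        ∫ ω, g (binary ω) ∂fairBits := fun g hg =>
      integral_map continuous_binary.aemeasurable hg.aestronglyMeasurable
    have h_digit : ∀ v, ∫ ω, h (binary (Function.update ω 0 v)) ∂fairBits =
        ∫ t, h ((digit v + t) / 2) ∂fairBits.map binary := fun v => by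
      rw [h_map _ (by fun_prop)]
      conv_rhs => rw [← measurePreserving_shift.map_eq]
      rw [integral_map measurePreserving_shift.aemeasurable
        (by have := continuous_binary; fun_prop)]
      simp [binary_eq (Function.update _ 0 v)]
    rw [h_map h h.continuous, integral_update 0, h_digit, h_digit]
    exact (h.compContinuous ⟨binary, continuous_binary⟩).integrable _

theorem integral_eq_mean_halves {g : ℝ → ℝ} (hg : Continuous g) :
    ∫ t in (0 : ℝ)..1, g t = mix (1 / 2) (∫ t in (0 : ℝ)..1, g ((digit true + t) / 2))
      (∫ t in (0 : ℝ)..1, g ((digit false + t) / 2)) := by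
  have h_half : ∀ v, ∫ t in (0 : ℝ)..1, g ((digit v + t) / 2) =
      2 * ∫ t in (digit v / 2)..((digit v + 1) / 2), g t := fun v => by
    have h := intervalIntegral.integral_comp_add_div (a := 0) (b := 1) g (two_ne_zero' ℝ)
      (digit v / 2)
    simp only [add_div, zero_div, add_zero, smul_eq_mul] at h ⊢
    exact h
  rw [h_half, h_half, ← intervalIntegral.integral_add_adjacent_intervals (b := 1 / 2)
    (hg.intervalIntegrable _ _) (hg.intervalIntegrable _ _)]
  simp only [digit, mix]
  norm_num
  ring

theorem isSelfSimilar_volume : IsSelfSimilar (volume.restrict (Set.Icc 0 1)) where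
  ae_mem := ae_restrict_mem measurableSet_Icc
  integral_eq h := by
    simp only [integral_Icc_eq_integral_Ioc, ← intervalIntegral.integral_of_le zero_le_one]
    exact integral_eq_mean_halves h.continuous

namespace IsSelfSimilar

variable {μ ν : Measure ℝ} [IsProbabilityMeasure μ] [IsProbabilityMeasure ν]

theorem norm_integral_sub_apply_zero_le (hμ : IsSelfSimilar μ)
    {h : BoundedContinuousFunction ℝ ℝ} {ε : ℝ}
    (hε : ∀ t ∈ Set.Icc (0 : ℝ) 1, ‖h t - h 0‖ ≤ ε) : ‖∫ t, h t ∂μ - h 0‖ ≤ ε := by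
  have h_sub : ∫ t, (h t - h 0) ∂μ = ∫ t, h t ∂μ - h 0 := by
    rw [integral_sub (h.integrable μ) (integrable_const _)]
    simp
  simpa [h_sub] using norm_integral_le_of_norm_le_const (hμ.ae_mem.mono hε)

/-- Induction on `n`: appending a digit in front halves all distances. -/
theorem dist_integral_le (hμ : IsSelfSimilar μ) (hν : IsSelfSimilar ν) {ε : ℝ} (n : ℕ)
    (h : BoundedContinuousFunction ℝ ℝ) (hε : ∀ a ∈ Set.Icc (0 : ℝ) 1, ∀ b ∈ Set.Icc (0 : ℝ) 1,
      dist a b ≤ (1 / 2) ^ n → dist (h a) (h b) ≤ ε) :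
    dist (∫ t, h t ∂μ) (∫ t, h t ∂ν) ≤ ε + ε := by
  induction n generalizing h with
  | zero =>
    have h_osc : ∀ t ∈ Set.Icc (0 : ℝ) 1, ‖h t - h 0‖ ≤ ε := fun t ht => by
      refine hε t ht 0 (by simp) ?_
      simpa using Real.dist_le_of_mem_Icc ht (Set.left_mem_Icc.2 zero_le_one)
    exact dist_triangle_right _ _ (h 0) |>.trans (add_le_add
      (hμ.norm_integral_sub_apply_zero_le h_osc) (hν.norm_integral_sub_apply_zero_le h_osc))
  | succ n ih =>
    have h_half : ∀ v, dist (∫ t, h ((digit v + t) / 2) ∂μ) (∫ t, h ((digit v + t) / 2) ∂ν) ≤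
        ε + ε := fun v => by
      refine ih (h.compContinuous ⟨fun t => (digit v + t) / 2, by fun_prop⟩) fun a ha b hb hab => ?_
      have h_mem : ∀ t ∈ Set.Icc (0 : ℝ) 1, (digit v + t) / 2 ∈ Set.Icc (0 : ℝ) 1 := fun t ht => by
        have := digit_mem_Icc v
        constructor <;> linarith [this.1, this.2, ht.1, ht.2]
      refine hε _ (h_mem a ha) _ (h_mem b hb) ?_
      calc dist ((digit v + a) / 2) ((digit v + b) / 2) = dist a b / 2 := by
            rw [Real.dist_eq, Real.dist_eq, ← sub_div, add_sub_add_left_eq_sub, abs_div, abs_two]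
        _ ≤ (1 / 2) ^ (n + 1) := by
            rw [pow_succ]
            linarith
    rw [hμ.integral_eq, hν.integral_eq]
    have h_true := abs_le.1 (h_half true)
    have h_false := abs_le.1 (h_half false)
    rw [Real.dist_eq, abs_le]
    unfold mix
    constructor <;> linarith [h_true.1, h_true.2, h_false.1, h_false.2]

theorem eq (hμ : IsSelfSimilar μ) (hν : IsSelfSimilar ν) : μ = ν := by
  refine ext_of_forall_integral_eq_of_IsFiniteMeasure fun h => ?_
  refine eq_of_forall_dist_le fun ε hε => ?_
  have h_unif := isCompact_Icc.uniformContinuousOn_of_continuous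
    (h.continuous.continuousOn (s := Set.Icc 0 1))
  obtain ⟨δ, hδ, h_osc⟩ := Metric.uniformContinuousOn_iff_le.1 h_unif (ε / 2) (half_pos hε)
  obtain ⟨n, hn⟩ := exists_pow_lt_of_lt_one hδ (one_half_lt_one (α := ℝ))
  rw [← add_halves ε]
  exact hμ.dist_integral_le hν n h fun a ha b hb hab => h_osc a ha b hb (hab.trans hn.le)

end IsSelfSimilar

theorem measurePreserving_binary :
    MeasurePreserving binary fairBits (volume.restrict (Set.Icc 0 1)) := by
  have := Measure.isProbabilityMeasure_map (μ := fairBits) continuous_binary.aemeasurable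
  have : IsProbabilityMeasure (volume.restrict (Set.Icc (0 : ℝ) 1)) := ⟨by simp⟩
  exact ⟨continuous_binary.measurable, isSelfSimilar_map_binary.eq isSelfSimilar_volume⟩

/-- The number with binary expansion `0.ωⱼωⱼ₊₁ωⱼ₊₂…`: the probability that a bag with bits `ω`
whose query has reached the index `j` answers `1`. -/
def binaryTail (j : ℕ) (ω : ℕ → Bool) : ℝ := binary fun i => ω (i + j)

theorem binaryTail_mem_Icc (j : ℕ) (ω : ℕ → Bool) : binaryTail j ω ∈ Set.Icc 0 1 :=
  binary_mem_Icc _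

@[fun_prop]
theorem measurable_binary : Measurable binary := continuous_binary.measurable

@[fun_prop]
theorem measurable_binaryTail (j : ℕ) : Measurable (binaryTail j) := by
  unfold binaryTail
  fun_prop

theorem mix_binaryTail (j : ℕ) (ω : ℕ → Bool) (a b : ℝ) : mix (binaryTail j ω) a b =
    mix (1 / 2) (mix (digit (ω j)) a b) (mix (binaryTail (j + 1) ω) a b) := by
  have h_tail : binaryTail j ω = (digit (ω j) + binaryTail (j + 1) ω) / 2 := by
    unfold binaryTail
    rw [binary_eq]
    simp only [zero_add, add_assoc, add_comm 1]
  rw [h_tail]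
  unfold mix
  ring

/-- The bits of `ω`, overridden by the known bits of a bag. -/
def fill (bits : ℕ → Option Bool) (ω : ℕ → Bool) : ℕ → Bool := fun i => (bits i).getD (ω i)

@[fun_prop]
theorem measurable_fill (bits : ℕ → Option Bool) : Measurable (fill bits) := by
  refine measurable_pi_lambda _ fun i => ?_
  unfold fill
  cases bits i with
  | none => exact measurable_pi_apply i
  | some v => exact measurable_const

theorem fill_apply {bits : ℕ → Option Bool} {j : ℕ} {v : Bool} (h : bits j = some v)
    (ω : ℕ → Bool) : fill bits ω j = v := by
  simp [fill, h]

theorem fill_update {bits : ℕ → Option Bool} {j : ℕ} (h : bits j = none) (v : Bool)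
    (ω : ℕ → Bool) :
    fill bits (Function.update ω j v) = fill (Function.update bits j (some v)) ω := by
  funext i
  by_cases hi : i = j
  · subst hi
    simp [fill, h]
  · simp [fill, hi]

/-- The mean of a function of the bits of a bag, some of which are known. -/
def bagMean (bits : ℕ → Option Bool) (G : (ℕ → Bool) → ℝ) : ℝ≥0∞ :=
  ∫⁻ ω, ENNReal.ofReal (G (fill bits ω)) ∂fairBits

theorem bagMean_le_one (bits : ℕ → Option Bool) {G : (ℕ → Bool) → ℝ} (hG : ∀ ω, G ω ≤ 1) :
    bagMean bits G ≤ 1 := by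
  refine (lintegral_mono (g := fun _ => 1) fun ω => ENNReal.ofReal_le_one.2 (hG _)).trans_eq ?_
  simp

theorem expect_bagMean {bits : ℕ → Option Bool} {x : NNReal} (hx : x ≤ 1)
    {G : Bool → (ℕ → Bool) → ℝ} (h_meas : ∀ r, Measurable (G r)) (h_nonneg : ∀ r ω, 0 ≤ G r ω) :
    expect (ber x hx) (fun r => bagMean bits (G r)) =
      bagMean bits fun ω => mix x (G true ω) (G false ω) := by
  have h_fill : ∀ r, Measurable fun ω => ENNReal.ofReal (G r (fill bits ω)) := by fun_prop
  unfold bagMean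
  rw [← lintegral_expect _ h_fill]
  simp only [expect_ber_ofReal x hx fun r => h_nonneg r _]

theorem expect_coin_bagMean {bits : ℕ → Option Bool} {G : Bool → (ℕ → Bool) → ℝ}
    (h_meas : ∀ r, Measurable (G r)) (h_nonneg : ∀ r ω, 0 ≤ G r ω) :
    expect coin (fun r => bagMean bits (G r)) =
      bagMean bits fun ω => mix (1 / 2) (G true ω) (G false ω) := by
  refine (expect_bagMean _ h_meas h_nonneg).trans ?_
  simp only [NNReal.coe_div, NNReal.coe_one, NNReal.coe_ofNat]

theorem bagMean_eq_expect_update {bits : ℕ → Option Bool} {j : ℕ} (hj : bits j = none)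
    {G : (ℕ → Bool) → ℝ} (hG : Measurable G) :
    bagMean bits G = expect coin fun v => bagMean (Function.update bits j (some v)) G := by
  have h_fill : Measurable fun ω => ENNReal.ofReal (G (fill bits ω)) := by fun_prop
  unfold bagMean
  rw [lintegral_update j h_fill]
  simp only [fill_update hj]

theorem bagMean_of_apply {bits : ℕ → Option Bool} {j : ℕ} {v : Bool} (hj : bits j = some v)
    (F : Bool → (ℕ → Bool) → ℝ) : bagMean bits (fun ω => F (ω j) ω) = bagMean bits (F v) := by
  unfold bagMean
  simp only [fill_apply hj]

section Value

variable {M : Machine R} {i₀ : Fin R.numBags} {x : NNReal} {h : M.State → Store R → ℝ → ℝ}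

/-- `h s m u` is the probability of output `1` in the control state `s` with the store `m`, given
that the number in the bag `i₀` is `u`. -/
structure Machine.IsValue (M : Machine R) (i₀ : Fin R.numBags) (x : NNReal)
    (h : M.State → Store R → ℝ → ℝ) : Prop where
  measurable : ∀ s m, Measurable (h s m)
  mem_Icc : ∀ s m, ∀ u ∈ Set.Icc (0 : ℝ) 1, h s m u ∈ Set.Icc 0 1
  step : ∀ s m, ∀ u ∈ Set.Icc (0 : ℝ) 1, match M.action s with
    | .halt b => h s m u = digit b
    | .flip q => h s m u = mix (1 / 2) (h (q true) m u) (h (q false) m u)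
    | .input q => h s m u = mix x (h (q true) m u) (h (q false) m u)
    | .update f => h s m u = h (f m).1 (f m).2 u
    | .newBag _ _ => False
    | .bag i q => i = i₀ ∧ h s m u = mix u (h (q true) m u) (h (q false) m u)

/-- The value of a configuration when all the bits of the bag are known. If a query is under way,
its answer is governed by the digits from the current index on. -/
def quenchedValue (i₀ : Fin R.numBags) (h : M.State → Store R → ℝ → ℝ) (c : Config M)
    (ω : ℕ → Bool) : ℝ :=
  match M.action c.state with
  | .bag _ q => mix (binaryTail (c.bag i₀).ptr ω) (h (q true) c.store (binary ω))
      (h (q false) c.store (binary ω))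
  | _ => h c.state c.store (binary ω)

/-- The value of a configuration, averaged over the bits of the bag that are not known yet. -/
def annealedValue (i₀ : Fin R.numBags) (h : M.State → Store R → ℝ → ℝ) (c : Config M) : ℝ≥0∞ :=
  bagMean (c.bag i₀).bits (quenchedValue i₀ h c)

/-- The configurations in which a query of the bag can only be under way in a query state. -/
def idleOrQuery (M : Machine R) (i₀ : Fin R.numBags) : Set (Config M) :=
  {c | (∀ i q, M.action c.state ≠ .bag i q) → (c.bag i₀).ptr = 0}

namespace Machine.IsValue

theorem mem_Icc_binary (hv : M.IsValue i₀ x h) (s : M.State) (m : Store R) (ω : ℕ → Bool) :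
    h s m (binary ω) ∈ Set.Icc 0 1 :=
  hv.mem_Icc s m _ (binary_mem_Icc ω)

theorem measurable_binary (hv : M.IsValue i₀ x h) (s : M.State) (m : Store R) :
    Measurable fun ω => h s m (binary ω) :=
  (hv.measurable s m).comp Buffon.measurable_binary

theorem quenchedValue_le_one (hv : M.IsValue i₀ x h) (c : Config M) (ω : ℕ → Bool) :
    quenchedValue i₀ h c ω ≤ 1 := by
  unfold quenchedValue
  split
  · exact (mix_mem_Icc (binaryTail_mem_Icc _ ω) (hv.mem_Icc_binary _ _ ω)
      (hv.mem_Icc_binary _ _ ω)).2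
  · exact (hv.mem_Icc_binary _ _ ω).2

theorem quenchedValue_of_ptr_eq_zero (hv : M.IsValue i₀ x h) {c : Config M}
    (hc : (c.bag i₀).ptr = 0) :
    quenchedValue i₀ h c = fun ω => h c.state c.store (binary ω) := by
  funext ω
  have h_step := hv.step c.state c.store _ (binary_mem_Icc ω)
  unfold quenchedValue
  cases h_act : M.action c.state with
  | bag i q =>
    rw [h_act] at h_step
    rw [h_step.2, hc]
    rfl
  | _ => rfl

theorem annealedValue_of_ptr_eq_zero (hv : M.IsValue i₀ x h) {c : Config M}
    (hc : (c.bag i₀).ptr = 0) :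
    annealedValue i₀ h c = bagMean (c.bag i₀).bits fun ω => h c.state c.store (binary ω) := by
  rw [annealedValue, hv.quenchedValue_of_ptr_eq_zero hc]

theorem annealedValue_setBag (hv : M.IsValue i₀ x h) (c : Config M) (bits : ℕ → Option Bool)
    (k : ℕ) (s : M.State) : annealedValue i₀ h (c.setBag i₀ ⟨bits, 0⟩ k s) =
      bagMean bits fun ω => h s c.store (binary ω) := by
  rw [hv.annealedValue_of_ptr_eq_zero (by simp), Config.setBag_bag_self]
  rfl

theorem step_mem_idleOrQuery (hv : M.IsValue i₀ x h) {X : PMF Bool} {c c' : Config M}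
    (hc : c ∈ idleOrQuery M i₀) (hc' : c' ∈ (M.step X c).support) : c' ∈ idleOrQuery M i₀ := by
  have h_step := hv.step c.state c.store 0 (by simp)
  rw [M.step_eq] at hc'
  unfold idleOrQuery at hc ⊢
  rw [Set.mem_ofPred_eq] at hc ⊢
  cases h_act : M.action c.state with simp only [h_act] at h_step hc hc'
  | halt | update =>
    rw [PMF.support_pure, Set.mem_singleton_iff] at hc'
    exact fun _ => hc' ▸ hc (by simp)
  | flip | input =>
    obtain ⟨r, -, rfl⟩ := (PMF.mem_support_map_iff _ _ _).1 hc'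
    exact fun _ => hc (by simp)
  | bag i q =>
    obtain ⟨rfl, -⟩ := h_step
    obtain ⟨heads, -, hc'⟩ := (PMF.mem_support_bind_iff _ _ _).1 hc'
    cases heads with
    | false =>
      rw [if_neg Bool.false_ne_true, PMF.support_pure, Set.mem_singleton_iff] at hc'
      exact fun h_idle => (h_idle i q (hc' ▸ h_act)).elim
    | true =>
      rw [if_pos rfl] at hc'
      split at hc'
      · rw [PMF.support_pure, Set.mem_singleton_iff] at hc'
        simp [hc', Config.setBag]
      · obtain ⟨v, -, rfl⟩ := (PMF.mem_support_map_iff _ _ _).1 hc'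
        simp [Config.setBag]

theorem expect_query (hv : M.IsValue i₀ x h) {X : PMF Bool} {c : Config M} {q : Bool → M.State}
    (h_act : M.action c.state = .bag i₀ q) :
    expect (M.step X c) (annealedValue i₀ h) = annealedValue i₀ h c := by
  set bits := (c.bag i₀).bits with h_bits
  set j := (c.bag i₀).ptr with h_ptr
  let G : Bool → (ℕ → Bool) → ℝ := fun heads ω =>
    mix (bif heads then digit (ω j) else binaryTail (j + 1) ω)
      (h (q true) c.store (binary ω)) (h (q false) c.store (binary ω))
  have h_true : G true = fun ω => h (q (ω j)) c.store (binary ω) :=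
    funext fun ω => mix_digit (ω j) fun b => h (q b) c.store (binary ω)
  have h_meas : ∀ heads, Measurable (G heads) := fun heads =>
    measurable_mix (by cases heads <;> dsimp only [cond] <;> fun_prop)
      (hv.measurable_binary _ _) (hv.measurable_binary _ _)
  have h_nonneg : ∀ heads ω, 0 ≤ G heads ω := fun heads ω => by
    refine mix_nonneg ?_ (hv.mem_Icc_binary _ _ ω).1 (hv.mem_Icc_binary _ _ ω).1
    cases heads
    · exact binaryTail_mem_Icc _ ω
    · exact digit_mem_Icc _
  have h_split : annealedValue i₀ h c = expect coin fun heads => bagMean bits (G heads) := by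
    rw [expect_coin_bagMean h_meas h_nonneg]
    unfold annealedValue quenchedValue
    simp only [h_act, ← h_ptr, ← h_bits, mix_binaryTail j, G, cond]
  rw [h_split, M.step_eq, h_act, expect_bind]
  refine expect_congr fun heads _ => ?_
  cases heads with
  | false =>
    rw [if_neg Bool.false_ne_true, expect_pure]
    unfold annealedValue quenchedValue
    rw [Config.setBag_bag_self, show M.action (Config.setBag ..).state = _ from h_act]
    rfl
  | true =>
    rw [if_pos rfl, h_true]
    split
    case h_1 v hv_bit =>
      rw [expect_pure, hv.annealedValue_setBag]
      exact (bagMean_of_apply hv_bit fun b ω => h (q b) c.store (binary ω)).symm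
    case h_2 h_new =>
      rw [expect_map, bagMean_eq_expect_update h_new (h_true ▸ h_meas true)]
      refine expect_congr fun v _ => ?_
      rw [hv.annealedValue_setBag]
      exact (bagMean_of_apply (Function.update_self ..) fun b ω => h (q b) c.store (binary ω)).symm

theorem expect_step (hx : x ≤ 1) (hv : M.IsValue i₀ x h) {c : Config M}
    (hc : c ∈ idleOrQuery M i₀) :
    expect (M.step (ber x hx) c) (annealedValue i₀ h) = annealedValue i₀ h c := by
  have h_step := fun ω => hv.step c.state c.store _ (binary_mem_Icc ω)
  have h_mean : ∀ c' : Config M, c'.bag i₀ = c.bag i₀ → (∀ i q, M.action c.state ≠ .bag i q) →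
      annealedValue i₀ h c' = bagMean (c.bag i₀).bits fun ω => h c'.state c'.store (binary ω) :=
    fun c' h_bag h_idle => by rw [hv.annealedValue_of_ptr_eq_zero (h_bag ▸ hc h_idle), h_bag]
  cases h_act : M.action c.state with simp only [h_act] at h_step h_mean
  | halt b => rw [M.step_eq, h_act, expect_pure]
  | flip q =>
    rw [M.step_eq, h_act, expect_map, h_mean c rfl (by simp)]
    simp only [h_step]
    rw [← expect_coin_bagMean (G := fun r ω => h (q r) c.store (binary ω))
      (fun r => hv.measurable_binary _ _) fun r ω => (hv.mem_Icc_binary _ _ ω).1]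
    exact expect_congr fun r _ => h_mean _ rfl (by simp)
  | input q =>
    rw [M.step_eq, h_act, expect_map, h_mean c rfl (by simp)]
    simp only [h_step]
    rw [← expect_bagMean hx (G := fun r ω => h (q r) c.store (binary ω))
      (fun r => hv.measurable_binary _ _) fun r ω => (hv.mem_Icc_binary _ _ ω).1]
    exact expect_congr fun r _ => h_mean _ rfl (by simp)
  | update f =>
    rw [M.step_eq, h_act, expect_pure, h_mean c rfl (by simp),
      h_mean (c.move (f c.store)) rfl (by simp)]
    simp only [h_step]
    rfl
  | newBag => exact (h_step fun _ => false).elim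
  | bag i q =>
    obtain ⟨rfl, -⟩ := h_step fun _ => false
    exact hv.expect_query h_act

theorem isMartingale (hx : x ≤ 1) (hv : M.IsValue i₀ x h) :
    IsMartingale M (ber x hx) (idleOrQuery M i₀) (annealedValue i₀ h) where
  init_mem _ := rfl
  step_mem _ hc _ hc' := hv.step_mem_idleOrQuery hc hc'
  le_one c := bagMean_le_one _ (hv.quenchedValue_le_one c)
  expect_step _ hc := hv.expect_step hx hc
  output c b h_out := by
    have h_act := Config.output_eq_some_iff.1 h_out
    have h_step := fun ω => hv.step c.state c.store _ (binary_mem_Icc ω)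
    simp only [h_act] at h_step
    unfold annealedValue quenchedValue
    simp only [h_act, h_step]
    cases b <;> simp [bagMean, digit]

theorem annealedValue_init (hv : M.IsValue i₀ x h) : annealedValue i₀ h (Config.init M) =
    ENNReal.ofReal (∫ u in (0 : ℝ)..1, h M.start (Store.empty R) u) := by
  have h_meas := hv.measurable M.start (Store.empty R)
  have h_mem : ∀ᵐ u ∂volume.restrict (Set.Icc 0 1),
      h M.start (Store.empty R) u ∈ Set.Icc 0 1 :=
    (ae_restrict_mem measurableSet_Icc).mono (hv.mem_Icc _ _)
  rw [hv.annealedValue_of_ptr_eq_zero rfl, intervalIntegral.integral_of_le zero_le_one,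
    ← integral_Icc_eq_integral_Ioc, ofReal_integral_eq_lintegral_ofReal
      (.of_mem_Icc 0 1 h_meas.aemeasurable h_mem) (h_mem.mono fun _ hu => hu.1),
    ← measurePreserving_binary.lintegral_comp h_meas.ennreal_ofReal]
  rfl

end Machine.IsValue

end Value

theorem stronglyRealizable_of_isValue {φ : ℝ → ℝ} (M : Machine R) (i₀ : Fin R.numBags)
    (h_descends : ∀ x : NNReal, x < 1 → ∃ d, M.Descends x d)
    (h_value : ∀ x : NNReal, x < 1 → ∃ h, M.IsValue i₀ x h ∧
      ∫ u in (0 : ℝ)..1, h M.start (Store.empty R) u = φ x) :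
    StronglyRealizable R φ := by
  refine ⟨M, fun x hx => ?_⟩
  obtain ⟨d, hd⟩ := h_descends x hx
  obtain ⟨h, hv, hφ⟩ := h_value x hx
  have h_foster := hd.isFoster hx.le
  have h_nonneg : 0 ≤ φ x := hφ ▸ intervalIntegral.integral_nonneg zero_le_one
    fun u hu => (hv.mem_Icc _ _ u hu).1
  obtain ⟨h_true, h_false⟩ := (hv.isMartingale hx.le).outputsWithProb
    h_foster.tendsto_expect_not_halted h_nonneg (hφ ▸ hv.annealedValue_init)
  exact ⟨h_true, h_false, h_foster.exponentialTails⟩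

/-- The probability that an even number (if `p`) or an odd number (if not) of independent trials
of success probability `t` succeed before the first failure. -/
def parityProb (p : Bool) (t : ℝ) : ℝ := orient p (1 / (1 + t))

theorem mix_parityProb_not (p : Bool) {t : ℝ} (ht : 0 ≤ t) :
    mix t (parityProb (!p) t) (digit p) = parityProb p t := by
  have h_pos : 1 + t ≠ 0 := by positivity
  unfold parityProb
  rw [orient_not, ← orient_one, mix_orient]
  congr 1
  unfold mix
  field_simp
  ring

theorem parityProb_mem_Icc (p : Bool) {t : ℝ} (ht : 0 ≤ t) :
    parityProb p t ∈ Set.Icc (0 : ℝ) 1 :=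
  orient_mem_Icc p ⟨by positivity, div_le_one_of_le₀ (le_add_of_nonneg_right ht) (by positivity)⟩

@[fun_prop]
theorem measurable_parityProb {f : ℝ → ℝ} (p : Bool) (hf : Measurable f) :
    Measurable fun u => parityProb p (f u) := by
  unfold parityProb
  fun_prop

/-- The stages of a loop whose rounds consist of `n + 1` trials each: `(i, p)` stands for the trial
after which `i` more complete the round, and `p` is the output if the trial fails. -/
abbrev Stage (n : ℕ) := Fin (n + 1) × Bool

namespace Stage

variable {n : ℕ}

/-- The stage after a successful trial: the output is switched when a round is completed. -/
def next (k : Stage n) : Stage n := Fin.cases (Fin.last n, !k.2) (fun j => (j.castSucc, k.2)) k.1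

/-- The probability of output `1` before the trial of a stage, if trials succeed with probability
`t`: the rounds succeed with probability `t ^ (n + 1)`. -/
def value (t : ℝ) (k : Stage n) : ℝ :=
  mix (t ^ (k.1 + 1 : ℕ)) (parityProb (!k.2) (t ^ (n + 1))) (digit k.2)

theorem value_last {t : ℝ} (ht : 0 ≤ t) (p : Bool) :
    value t (Fin.last n, p) = parityProb p (t ^ (n + 1)) :=
  mix_parityProb_not p (pow_nonneg ht _)

theorem mix_value_next {t : ℝ} (ht : 0 ≤ t) (k : Stage n) :
    mix t (value t k.next) (digit k.2) = value t k := by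
  obtain ⟨i, p⟩ := k
  induction i using Fin.cases with
  | zero =>
    change mix t (value t (Fin.last n, !p)) (digit p) = _
    rw [value_last ht]
    simp [value]
  | succ j =>
    change mix t (value t (j.castSucc, p)) (digit p) = _
    simp only [value, Fin.val_castSucc, Fin.val_succ, pow_succ' t (j + 1 : ℕ), mix_mul]

theorem value_mem_Icc {t : ℝ} (ht : t ∈ Set.Icc 0 1) (k : Stage n) : value t k ∈ Set.Icc 0 1 :=
  mix_mem_Icc ⟨pow_nonneg ht.1 _, pow_le_one₀ ht.1 ht.2⟩
    (parityProb_mem_Icc _ (pow_nonneg ht.1 _)) (digit_mem_Icc _)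

@[fun_prop]
theorem measurable_value {f : ℝ → ℝ} (k : Stage n) (hf : Measurable f) :
    Measurable fun u => value (f u) k := by
  unfold value
  fun_prop

end Stage

/-- The trials of a loop, preceded by a trial whose failure leads to output `0`. Each trial of the
loop consists of an event of probability `y` and, if it occurs, a query of a bag. -/
abbrev Trial (n : ℕ) := Option (Stage n)

namespace Trial

variable {n : ℕ}

/-- The output if a trial fails. -/
def failOutput (k : Trial n) : Bool := k.elim false Prod.snd

/-- The probability of output `1` after the event of a trial has occurred. -/
def successValue (y u : ℝ) : Trial n → ℝ
  | none => Stage.value (y * u) (Fin.last n, true)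
  | some k => mix u (Stage.value (y * u) k.next) (digit k.2)

theorem successValue_mem_Icc {y u : ℝ} (hy : y ∈ Set.Icc 0 1) (hu : u ∈ Set.Icc 0 1)
    (k : Trial n) : successValue y u k ∈ Set.Icc 0 1 := by
  have hyu : y * u ∈ Set.Icc (0 : ℝ) 1 := unitInterval.mul_mem hy hu
  cases k with
  | none => exact Stage.value_mem_Icc hyu _
  | some k => exact mix_mem_Icc hu (Stage.value_mem_Icc hyu _) (digit_mem_Icc _)

@[fun_prop]
theorem measurable_successValue (y : ℝ) (k : Trial n) : Measurable fun u => successValue y u k := by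
  cases k <;> unfold successValue <;> fun_prop

/-- The probability of output `1` before a trial whose event has probability `y ^ j`, when all
later events have probability `y`. -/
def value (y : ℝ) (j : ℕ) (u : ℝ) (k : Trial n) : ℝ :=
  mix (y ^ j) (successValue y u k) (digit k.failOutput)

theorem value_some {y u : ℝ} (hy : 0 ≤ y) (hu : 0 ≤ u) (k : Stage n) :
    value y 1 u (some k) = Stage.value (y * u) k := by
  rw [value, pow_one]
  exact (mix_mul _ _ _ _).symm.trans (Stage.mix_value_next (mul_nonneg hy hu) k)

theorem value_mem_Icc {y u : ℝ} (hy : y ∈ Set.Icc 0 1) (hu : u ∈ Set.Icc 0 1) (j : ℕ)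
    (k : Trial n) : value y j u k ∈ Set.Icc 0 1 :=
  mix_mem_Icc ⟨pow_nonneg hy.1 j, pow_le_one₀ hy.1 hy.2⟩ (k.successValue_mem_Icc hy hu)
    (digit_mem_Icc _)

@[fun_prop]
theorem measurable_value (y : ℝ) (j : ℕ) (k : Trial n) : Measurable fun u => value y j u k := by
  unfold value
  fun_prop

theorem integral_value_none {y : ℝ} (hy : 0 ≤ y) :
    ∫ u in (0 : ℝ)..1, value y 1 u (none : Trial n) =
      ∫ w in (0 : ℝ)..y, 1 / (1 + w ^ (n + 1)) := by
  have h_scale := intervalIntegral.mul_integral_comp_mul_left (a := 0) (b := 1) (c := y)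
    (f := fun w => 1 / (1 + w ^ (n + 1)))
  rw [mul_zero, mul_one, ← intervalIntegral.integral_const_mul] at h_scale
  rw [← h_scale]
  refine intervalIntegral.integral_congr fun u hu => ?_
  rw [Set.uIcc_of_le zero_le_one] at hu
  simp only [value, successValue, Stage.value_last (mul_nonneg hy hu.1), parityProb, pow_one]
  simp [orient, digit, failOutput, mix]

end Trial

/-- The control states of a loop of trials: in `call k` the event of the trial `k` is awaited, and
in `query k` it has occurred and the bag is queried. -/
inductive LoopState (n : ℕ)
  | call (k : Trial n)
  | query (k : Stage n)
  | halt (b : Bool)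
  deriving Fintype

/-- The control state after the event of a trial has occurred. -/
def Trial.success {n : ℕ} : Trial n → LoopState n
  | none => .call (some (Fin.last n, true))
  | some k => .query k

namespace LoopState

variable {n : ℕ}

/-- The probability of output `1`, if the bag holds `u`, when the event of the next trial has
probability `y ^ j` and all later events have probability `y`. -/
def value (y : ℝ) (j : ℕ) (u : ℝ) : LoopState n → ℝ
  | call k => k.value y j u
  | query k => mix u (Trial.value y j u (some k.next)) (digit k.2)
  | halt b => digit b

theorem value_mem_Icc {y u : ℝ} (hy : y ∈ Set.Icc 0 1) (hu : u ∈ Set.Icc 0 1) (j : ℕ) :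
    ∀ s : LoopState n, s.value y j u ∈ Set.Icc 0 1
  | call k => k.value_mem_Icc hy hu j
  | query _ => mix_mem_Icc hu (Trial.value_mem_Icc hy hu j _) (digit_mem_Icc _)
  | halt b => digit_mem_Icc b

@[fun_prop]
theorem measurable_value (y : ℝ) (j : ℕ) (s : LoopState n) :
    Measurable fun u => s.value y j u := by
  cases s <;> unfold value <;> fun_prop

theorem value_success {y u : ℝ} (hy : 0 ≤ y) (hu : 0 ≤ u) (k : Trial n) :
    k.success.value y 1 u = k.successValue y u := by
  cases k with
  | none => exact Trial.value_some hy hu _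
  | some k => exact congrArg (mix u · (digit k.2)) (Trial.value_some hy hu k.next)

end LoopState

theorem exists_nonneg_mul_one_sub_eq {x a : ℝ} (hx : x < 1) (ha : 0 ≤ a) :
    ∃ C, 0 ≤ C ∧ C * (1 - x) = a :=
  ⟨a / (1 - x), div_nonneg ha (sub_pos.2 hx).le, div_mul_cancel₀ a (sub_pos.2 hx).ne'⟩

/-- The registers consisting of one bag. -/
abbrev oneBag : Registers := ⟨0, 0, 0, 1⟩

/-- The machine that runs a loop of trials whose events are the successes of the input generator,
with `n + 1` trials in a round. -/
def powerMachine (n : ℕ) : Machine oneBag where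
  State := LoopState n
  finite := inferInstance
  start := .call none
  code
    | .call k => .input fun r => if r then k.success else .halt k.failOutput
    | .query k => .bag (0 : Fin 1) fun r => if r then .call (some k.next) else .halt k.2
    | .halt b => .halt b

theorem exists_descends_powerMachine (n : ℕ) {x : ℝ} (hx₀ : 0 ≤ x) (hx : x < 1) :
    ∃ d, (powerMachine n).Descends x d := by
  obtain ⟨C, hC₀, hC⟩ := exists_nonneg_mul_one_sub_eq hx (by norm_num : (0 : ℝ) ≤ 3)
  let d : LoopState n → ℝ
    | .call _ => C
    | .query _ => C + 2
    | .halt _ => 0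
  refine ⟨d, ?_⟩
  rintro (k | k | b)
  · have h_success : d k.success ≤ C + 2 := by
      cases k
      · exact le_add_of_nonneg_right zero_le_two
      · exact le_rfl
    refine ⟨hC₀, ?_⟩
    change mix x (d k.success) 0 + 1 ≤ C
    unfold mix
    nlinarith
  · refine ⟨by positivity, fun r => ?_⟩
    cases r
    · change (0 : ℝ) + 2 ≤ C + 2
      linarith
    · exact le_rfl
  · exact ⟨le_rfl, trivial⟩

theorem isValue_powerMachine (n : ℕ) {x : NNReal} (hx : x ≤ 1) :
    (powerMachine n).IsValue (0 : Fin 1) x fun s _ u => LoopState.value x 1 u s where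
  measurable s _ := LoopState.measurable_value _ _ s
  mem_Icc s _ _ hu := s.value_mem_Icc ⟨x.coe_nonneg, by exact_mod_cast hx⟩ hu 1
  step := by
    rintro (k | k | b) - u hu
    · change LoopState.value _ _ _ _ = mix x (k.success.value x 1 u) _
      rw [LoopState.value_success x.coe_nonneg hu.1, LoopState.value, Trial.value, pow_one]
      rfl
    · exact ⟨rfl, rfl⟩
    · rfl

theorem stronglyRealizable_integral_one_div_one_add_pow (n : ℕ) :
    StronglyRealizable oneBag fun x => ∫ w in (0 : ℝ)..x, 1 / (1 + w ^ (n + 1)) := by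
  refine stronglyRealizable_of_isValue (powerMachine n) (0 : Fin 1)
    (fun x hx => exists_descends_powerMachine n x.coe_nonneg (by exact_mod_cast hx))
    fun x hx => ⟨_, isValue_powerMachine n hx.le, ?_⟩
  exact Trial.integral_value_none x.coe_nonneg

theorem StronglyRealizable.congr {φ ψ : ℝ → ℝ} (hφ : StronglyRealizable R φ)
    (h : ∀ x : NNReal, x < 1 → φ x = ψ x) : StronglyRealizable R ψ := by
  obtain ⟨M, hM⟩ := hφ
  exact ⟨M, fun x hx => h x hx ▸ hM x hx⟩

theorem stronglyRealizable_log : StronglyRealizable oneBag fun x => Real.log (1 + x) := by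
  refine (stronglyRealizable_integral_one_div_one_add_pow 0).congr fun x _ => ?_
  simp only [zero_add, pow_one]
  rw [intervalIntegral.integral_comp_add_left (fun w => 1 / w) (1 : ℝ), add_zero,
    integral_one_div_of_pos one_pos (by positivity), div_one]

theorem stronglyRealizable_arctan : StronglyRealizable oneBag Real.arctan :=
  (stronglyRealizable_integral_one_div_one_add_pow 1).congr fun x _ => by
    simp only [Nat.reduceAdd, integral_one_div_one_add_sq, Real.arctan_zero, sub_zero]

/-- The probability that a random walk on the integers ever moves one level down, if it is killed
with probability `1 - x` before each of its steps. -/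
def passageProb (x : ℝ) : ℝ := x / (1 + √(1 - x ^ 2))

theorem passageProb_mem_Icc {x : ℝ} (hx : x ∈ Set.Icc 0 1) : passageProb x ∈ Set.Icc 0 1 := by
  have h_sqrt := Real.sqrt_nonneg (1 - x ^ 2)
  exact ⟨div_nonneg hx.1 (by positivity), div_le_one_of_le₀ (by linarith [hx.2]) (by positivity)⟩

/-- The walk has one level to descend after a step down, and two levels after a step up. -/
theorem mul_one_add_passageProb_sq {x : ℝ} (hx : x ∈ Set.Icc 0 1) :
    x * (1 + passageProb x ^ 2) = 2 * passageProb x := by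
  have h_sq : √(1 - x ^ 2) ^ 2 = 1 - x ^ 2 := Real.sq_sqrt (by nlinarith [hx.1, hx.2])
  have h_pos : 1 + √(1 - x ^ 2) ≠ 0 := by positivity
  unfold passageProb
  field_simp
  linear_combination x * h_sq

theorem arctan_passageProb {x : ℝ} (hx : x ∈ Set.Icc 0 1) :
    Real.arctan (passageProb x) = 1 / 2 * Real.arcsin x := by
  have hy := passageProb_mem_Icc hx
  set y := passageProb x
  have h_pos : 0 < 1 + y ^ 2 := by positivity
  have h_sin : Real.sin (2 * Real.arctan y) = x := by
    have h_sq := Real.sq_sqrt h_pos.le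
    calc Real.sin (2 * Real.arctan y) = 2 * y / √(1 + y ^ 2) ^ 2 := by
          rw [Real.sin_two_mul, Real.sin_arctan, Real.cos_arctan]
          ring
      _ = x := by rw [h_sq, div_eq_iff h_pos.ne', mul_one_add_passageProb_sq hx]
  have h_nonneg : 0 ≤ Real.arctan y := Real.arctan_nonneg.2 hy.1
  have h_le : Real.arctan y ≤ Real.pi / 4 := by
    rw [← Real.arctan_one]
    exact Real.arctan_strictMono.monotone hy.2
  rw [← h_sin, Real.arcsin_sin (by linarith [Real.pi_pos]) (by linarith)]
  ring

theorem Trial.value_passageProb {n : ℕ} {x : ℝ} (hx : x ∈ Set.Icc 0 1) (m : ℕ) (u : ℝ)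
    (k : Trial n) : k.value (passageProb x) (m + 1) u =
      mix x (mix (1 / 2) (k.value (passageProb x) (m + 2) u) (k.value (passageProb x) m u))
        (digit k.failOutput) := by
  unfold value mix
  linear_combination -(passageProb x ^ m * (k.successValue (passageProb x) u -
    digit k.failOutput) / 2) * mul_one_add_passageProb_sq hx

/-- The control states of a loop of trials whose events are the successes of a random walk: in
`toss k` the walk is about to move, and in `up k` and `down k` it moves. -/
inductive WalkState (n : ℕ)
  | loop (s : LoopState n)
  | toss (k : Trial n)
  | up (k : Trial n)
  | down (k : Trial n)
  deriving Fintype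

namespace WalkState

variable {n : ℕ}

/-- The probability of output `1` if the walk is at height `m` and the bag holds `u`, when walks
reach the level below with probability `y`. The walk succeeds at the level `-1`. -/
def value (y : ℝ) (m : ℕ) (u : ℝ) : WalkState n → ℝ
  | loop s => s.value y (m + 1) u
  | toss k => mix (1 / 2) (k.value y (m + 2) u) (k.value y m u)
  | up k => k.value y (m + 2) u
  | down k => k.value y m u

theorem value_mem_Icc {y u : ℝ} (hy : y ∈ Set.Icc 0 1) (hu : u ∈ Set.Icc 0 1) (m : ℕ) :
    ∀ s : WalkState n, s.value y m u ∈ Set.Icc 0 1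
  | loop s => s.value_mem_Icc hy hu _
  | toss k => mix_mem_Icc (by norm_num) (k.value_mem_Icc hy hu _) (k.value_mem_Icc hy hu _)
  | up k => k.value_mem_Icc hy hu _
  | down k => k.value_mem_Icc hy hu _

theorem measurable_value (y : ℝ) (m : ℕ) (s : WalkState n) :
    Measurable fun u => s.value y m u := by
  cases s <;> unfold value <;> fun_prop

end WalkState

/-- The registers consisting of one stack and one bag. -/
abbrev stackAndBag : Registers := ⟨0, 1, 0, 1⟩

/-- The machine that runs a loop of trials, with `n + 1` trials in a round, whose events are the
descents of a random walk below its initial height. The walk is killed if a call of the input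
generator fails, and its height is that of the stack. -/
def walkMachine (n : ℕ) : Machine stackAndBag where
  State := WalkState n
  finite := inferInstance
  start := .loop (.call none)
  code
    | .loop (.call k) => .input fun r => if r then .toss k else .loop (.halt k.failOutput)
    | .toss k => .flip fun r => if r then .up k else .down k
    | .up k => .push (0 : Fin 1) true (.loop (.call k))
    | .down k => .pop (0 : Fin 1) fun r => .loop (if r.isSome then .call k else k.success)
    | .loop (.query k) => .bag (0 : Fin 1) fun r =>
        .loop (if r then .call (some k.next) else .halt k.2)
    | .loop (.halt b) => .halt b

theorem exists_descends_walkMachine (n : ℕ) {x : ℝ} (hx : x < 1) :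
    ∃ d, (walkMachine n).Descends x d := by
  obtain ⟨C, hC₀, hC⟩ := exists_nonneg_mul_one_sub_eq hx (by norm_num : (0 : ℝ) ≤ 5)
  let d : WalkState n → ℝ
    | .loop (.call _) => C
    | .toss _ => C + 4
    | .up _ => C + 3
    | .down _ => C + 3
    | .loop (.query _) => C + 2
    | .loop (.halt _) => 0
  refine ⟨d, ?_⟩
  rintro ((k | k | b) | k | k | k)
  · refine ⟨hC₀, ?_⟩
    change mix x (C + 4) 0 + 1 ≤ C
    unfold mix
    nlinarith
  · refine ⟨by positivity, fun r => ?_⟩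
    cases r
    · change (0 : ℝ) + 2 ≤ C + 2
      linarith
    · exact le_rfl
  · exact ⟨le_rfl, trivial⟩
  · refine ⟨by positivity, ?_⟩
    change mix (1 / 2) (C + 3) (C + 3) + 1 ≤ C + 4
    unfold mix
    linarith
  · refine ⟨by positivity, fun _ => ?_⟩
    change C + 1 ≤ C + 3
    linarith
  · have h_success : d (.loop k.success) ≤ C + 2 := by
      cases k
      · exact le_add_of_nonneg_right zero_le_two
      · exact le_rfl
    refine ⟨by positivity, fun m => ?_⟩
    change d (.loop (if (m.stack (0 : Fin 1)).head?.isSome then .call k else k.success)) + 1 ≤ C + 3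
    split_ifs
    · change C + 1 ≤ C + 3
      linarith
    · linarith

theorem isValue_walkMachine (n : ℕ) {x : NNReal} (hx : (x : ℝ) ∈ Set.Icc 0 1) :
    (walkMachine n).IsValue (0 : Fin 1) x fun s m u =>
      WalkState.value (passageProb x) (m.stack (0 : Fin 1)).length u s where
  measurable s _ := WalkState.measurable_value _ _ s
  mem_Icc s _ _ hu := s.value_mem_Icc (passageProb_mem_Icc hx) hu _
  step := by
    rintro ((k | k | b) | k | k | k) m u hu
    · exact Trial.value_passageProb hx _ u k
    · exact ⟨rfl, rfl⟩
    · rfl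
    · rfl
    · have h_push : Function.update m.stack (0 : Fin 1) (true :: m.stack (0 : Fin 1)) (0 : Fin 1) =
          true :: m.stack (0 : Fin 1) := Function.update_self ..
      exact congrArg (fun l => Trial.value (passageProb x) (l.length + 1) u k) h_push.symm
    · have h_pop : Function.update m.stack (0 : Fin 1) (m.stack (0 : Fin 1)).tail (0 : Fin 1) =
          (m.stack (0 : Fin 1)).tail := Function.update_self ..
      refine .trans ?_ (congrArg (fun l => LoopState.value (passageProb x) (l.length + 1) u
        (if (m.stack (0 : Fin 1)).head?.isSome then .call k else k.success)) h_pop.symm)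
      cases m.stack (0 : Fin 1) with
      | nil =>
        refine .trans ?_ (LoopState.value_success (passageProb_mem_Icc hx).1 hu.1 k).symm
        simp [WalkState.value, Trial.value, mix]
      | cons => rfl

theorem stronglyRealizable_integral_passageProb (n : ℕ) :
    StronglyRealizable stackAndBag
      fun x => ∫ w in (0 : ℝ)..passageProb x, 1 / (1 + w ^ (n + 1)) := by
  refine stronglyRealizable_of_isValue (walkMachine n) (0 : Fin 1)
    (fun x hx => exists_descends_walkMachine n (by exact_mod_cast hx)) fun x hx => ?_
  have hx_mem : (x : ℝ) ∈ Set.Icc 0 1 := ⟨x.coe_nonneg, by exact_mod_cast hx.le⟩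
  exact ⟨_, isValue_walkMachine n hx_mem, Trial.integral_value_none (passageProb_mem_Icc hx_mem).1⟩

theorem stronglyRealizable_half_arcsin :
    StronglyRealizable stackAndBag fun x => 1 / 2 * Real.arcsin x := by
  refine (stronglyRealizable_integral_passageProb 1).congr fun x hx => ?_
  simp only [Nat.reduceAdd, integral_one_div_one_add_sq, Real.arctan_zero, sub_zero]
  exact arctan_passageProb ⟨x.coe_nonneg, by exact_mod_cast hx.le⟩

/-- The number whose binary expansion is the word `s` followed by the expansion of `t`. -/
def dyadicPoint (s : List Bool) (t : ℝ) : ℝ := s.foldr (fun v y => (digit v + y) / 2) t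

theorem dyadicPoint_append (s r : List Bool) (t : ℝ) :
    dyadicPoint (s ++ r) t = dyadicPoint s (dyadicPoint r t) :=
  List.foldr_append

theorem dyadicPoint_eq_add (s : List Bool) (t : ℝ) :
    dyadicPoint s t = dyadicPoint s 0 + (1 / 2) ^ s.length * t := by
  induction s with
  | nil => simp [dyadicPoint]
  | cons v s ih =>
    change (digit v + dyadicPoint s t) / 2 = (digit v + dyadicPoint s 0) / 2 + _
    rw [ih, List.length_cons, pow_succ]
    ring

@[fun_prop]
theorem continuous_dyadicPoint (s : List Bool) : Continuous (dyadicPoint s) := by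
  rw [funext (dyadicPoint_eq_add s)]
  fun_prop

theorem dyadicPoint_mem_Icc (s : List Bool) {t : ℝ} (ht : t ∈ Set.Icc 0 1) :
    dyadicPoint s t ∈ Set.Icc 0 1 := by
  induction s with
  | nil => exact ht
  | cons v s ih =>
    change (digit v + dyadicPoint s t) / 2 ∈ Set.Icc 0 1
    obtain ⟨h_nonneg, h_le⟩ := digit_mem_Icc v
    exact ⟨by linarith [ih.1], by linarith [ih.2]⟩

/-- The mean of `f` over the numbers whose expansion begins with `s`. -/
def dyadicMean (f : ℝ → ℝ) (s : List Bool) : ℝ := ∫ t in (0 : ℝ)..1, f (dyadicPoint s t)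

theorem dyadicMean_eq_mix {f : ℝ → ℝ} (hf : Continuous f) (s : List Bool) :
    dyadicMean f s = mix (1 / 2) (dyadicMean f (s ++ [true])) (dyadicMean f (s ++ [false])) := by
  unfold dyadicMean
  simp only [dyadicPoint_append]
  exact integral_eq_mean_halves (hf.comp (continuous_dyadicPoint s))

/-- For `t` in the dyadic interval of `s`, the mean of `f`, restricted to `w < t`, over the numbers
`w` whose expansion begins with `s`. -/
def meanBelow (f : ℝ → ℝ) (s : List Bool) (t : ℝ) : ℝ :=
  2 ^ s.length * ∫ w in (dyadicPoint s 0)..t, f w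

theorem meanBelow_dyadicPoint (f : ℝ → ℝ) (s : List Bool) (t : ℝ) :
    meanBelow f s (dyadicPoint s t) = ∫ r in (0 : ℝ)..t, f (dyadicPoint s r) := by
  have h_scale := intervalIntegral.mul_integral_comp_add_mul (a := 0) (b := t) (f := f)
    (c := (1 / 2) ^ s.length) (d := dyadicPoint s 0)
  simp only [← dyadicPoint_eq_add] at h_scale
  rw [meanBelow, ← h_scale, ← mul_assoc, ← mul_pow, mul_one_div_cancel two_ne_zero, one_pow,
    one_mul]

theorem dyadicMean_eq_meanBelow (f : ℝ → ℝ) (s : List Bool) :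
    dyadicMean f s = meanBelow f s (dyadicPoint s 1) :=
  (meanBelow_dyadicPoint f s 1).symm

theorem meanBelow_eq_mix {f : ℝ → ℝ} (hf : Continuous f) (s : List Bool) (v : Bool) (t : ℝ) :
    meanBelow f s t = mix (1 / 2) (meanBelow f (s ++ [v]) t)
      (if v then dyadicMean f (s ++ [false]) else 0) := by
  have h_left : dyadicPoint (s ++ [false]) 0 = dyadicPoint s 0 := by
    rw [dyadicPoint_append]
    simp [dyadicPoint, digit]
  cases v with
  | false =>
    simp only [meanBelow, h_left, mix, List.length_append, List.length_singleton, pow_succ,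
      Bool.false_eq_true, if_false]
    ring
  | true =>
    have h_mid : dyadicPoint (s ++ [false]) 1 = dyadicPoint (s ++ [true]) 0 := by
      rw [dyadicPoint_append, dyadicPoint_append]
      simp [dyadicPoint, digit]
    rw [if_pos rfl, dyadicMean_eq_meanBelow, h_mid]
    simp only [meanBelow, h_left, mix, List.length_append, List.length_singleton, pow_succ]
    rw [← intervalIntegral.integral_add_adjacent_intervals
      (hf.intervalIntegrable _ (dyadicPoint (s ++ [true]) 0)) (hf.intervalIntegrable _ t)]
    ring

/-- The mean of `f w`, restricted to `w < v`, over the numbers `w` and `v` whose expansions begin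
with `s` and `s'` respectively, where `s'` extends `s`. -/
def compareMean (f : ℝ → ℝ) (s s' : List Bool) : ℝ := dyadicMean (meanBelow f s) s'

section Continuity

variable {X : Type*} [TopologicalSpace X] {f : X → ℝ → ℝ}

theorem continuous_meanBelow (hf : Continuous f.uncurry) (s : List Bool) :
    Continuous (fun x => meanBelow (f x) s).uncurry := by
  have h_integral : Continuous fun z : X × ℝ => ∫ w in (dyadicPoint s 0)..z.2, f z.1 w :=
    intervalIntegral.continuous_parametric_intervalIntegral_of_continuous (by fun_prop)
      continuous_snd
  exact continuous_const.mul h_integral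

theorem continuous_dyadicMean (hf : Continuous f.uncurry) (s : List Bool) :
    Continuous fun x => dyadicMean (f x) s :=
  intervalIntegral.continuous_parametric_intervalIntegral_of_continuous' (by fun_prop) _ _

theorem continuous_compareMean (hf : Continuous f.uncurry) (s s' : List Bool) :
    Continuous fun x => compareMean (f x) s s' :=
  continuous_dyadicMean (continuous_meanBelow hf s) s'

end Continuity

theorem continuous_meanBelow_right {f : ℝ → ℝ} (hf : Continuous f) (s : List Bool) :
    Continuous (meanBelow f s) :=
  (continuous_meanBelow (f := fun _ : Unit => f) (hf.comp continuous_snd) s).comp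
    (.prodMk_right ())

/-- The first digit in which two numbers can differ decides which is less, or they share it. -/
theorem compareMean_cons {f : ℝ → ℝ} (hf : Continuous f) (s : List Bool) (v : Bool)
    (r : List Bool) :
    compareMean f s (s ++ v :: r) = mix (1 / 2) (compareMean f (s ++ [v]) (s ++ v :: r))
      (if v then dyadicMean f (s ++ [false]) else 0) := by
  have h_cont : Continuous fun t => meanBelow f (s ++ [v]) (dyadicPoint (s ++ v :: r) t) :=
    (continuous_meanBelow_right hf _).comp (continuous_dyadicPoint _)
  unfold compareMean
  rw [dyadicMean, dyadicMean]
  simp only [meanBelow_eq_mix hf s v, mix]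
  rw [intervalIntegral.integral_add ((h_cont.intervalIntegrable 0 1).const_mul _)
    intervalIntegrable_const, intervalIntegral.integral_const_mul, intervalIntegral.integral_const]
  simp

theorem integral_mem_Icc {f : ℝ → ℝ} {t : ℝ} (ht : t ∈ Set.Icc 0 1)
    (hf : ∀ w ∈ Set.Icc (0 : ℝ) 1, f w ∈ Set.Icc 0 1) : ∫ w in (0 : ℝ)..t, f w ∈ Set.Icc 0 1 := by
  have h_norm : ∀ w ∈ Set.uIoc 0 t, ‖f w‖ ≤ 1 := fun w hw => by
    rw [Set.uIoc_of_le ht.1] at hw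
    have h_mem := hf w ⟨hw.1.le, hw.2.trans ht.2⟩
    exact (Real.norm_of_nonneg h_mem.1).trans_le h_mem.2
  refine ⟨intervalIntegral.integral_nonneg ht.1 fun w hw => (hf w ⟨hw.1, hw.2.trans ht.2⟩).1, ?_⟩
  calc ∫ w in (0 : ℝ)..t, f w ≤ 1 * |t - 0| :=
        (Real.le_norm_self _).trans (intervalIntegral.norm_integral_le_of_norm_le_const h_norm)
    _ ≤ 1 := by rw [one_mul, sub_zero, abs_of_nonneg ht.1]; exact ht.2

theorem dyadicMean_mem_Icc {f : ℝ → ℝ} (hf : ∀ w ∈ Set.Icc (0 : ℝ) 1, f w ∈ Set.Icc 0 1)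
    (s : List Bool) : dyadicMean f s ∈ Set.Icc 0 1 :=
  integral_mem_Icc (by simp) fun _ ht => hf _ (dyadicPoint_mem_Icc s ht)

theorem compareMean_append_mem_Icc {f : ℝ → ℝ} (hf : ∀ w ∈ Set.Icc (0 : ℝ) 1, f w ∈ Set.Icc 0 1)
    (s r : List Bool) : compareMean f s (s ++ r) ∈ Set.Icc 0 1 := by
  refine integral_mem_Icc (by simp) fun t ht => ?_
  rw [dyadicPoint_append, meanBelow_dyadicPoint]
  exact integral_mem_Icc (dyadicPoint_mem_Icc r ht) fun w hw => hf _ (dyadicPoint_mem_Icc s hw)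

/-- The control states of a machine for the Gaussian integral. The first trial, whose stage is
`none`, makes no comparison; otherwise the stage is the output if the trial fails. -/
inductive GaussState
  | start
  | call (k : Option Bool)
  | secondCall (k : Option Bool)
  | query (k : Option Bool)
  | secondQuery (k : Option Bool)
  | toss (k : Option Bool)
  | rewind (p : Bool)
  | read (p : Bool)
  | extend (p : Bool)
  | append (p r : Bool)
  | compare (p r : Bool)
  | advance (p : Bool)
  | erase (p : Bool)
  | lower (p : Bool)
  | halt (b : Bool)
  deriving Fintype

/-- The registers consisting of one string and one bag. -/
abbrev stringAndBag : Registers := ⟨0, 0, 1, 1⟩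

/-- A machine that outputs `1` if a first call of the input generator succeeds and an even number
of the trials that follow succeed before the first failure. A trial consists of two calls, two
queries of the bag and a toss of the fair coin, and it draws a uniform number, which must be less
than its predecessor. Numbers are generated as far as the comparison needs, and the string holds
the digits of the last one that are known. -/
def gaussMachine : Machine stringAndBag where
  State := GaussState
  finite := inferInstance
  start := .start
  code
    | .start => .input fun r => if r then .call none else .halt false
    | .call k => .input fun r => if r then .secondCall k else .halt (k.getD true)
    | .secondCall k => .input fun r => if r then .query k else .halt (k.getD true)
    | .query k => .bag (0 : Fin 1) fun r => if r then .secondQuery k else .halt (k.getD true)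
    | .secondQuery k => .bag (0 : Fin 1) fun r => if r then .toss k else .halt (k.getD true)
    | .toss k => .flip fun r =>
        if r then k.elim (.call (some false)) .rewind else .halt (k.getD true)
    | .rewind p => .rewind (0 : Fin 1) (.read p)
    | .read p => .read (0 : Fin 1) fun r => r.elim (.extend p) (.compare p)
    | .extend p => .flip (.append p)
    | .append p r => .write (0 : Fin 1) r (.compare p r)
    | .compare p r => .flip fun d =>
        if d = r then .advance p else if r then .erase p else .halt p
    | .advance p => .advance (0 : Fin 1) (.read p)
    | .erase p => .erase (0 : Fin 1) (.lower p)
    | .lower p => .write (0 : Fin 1) false (.call (some !p))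
    | .halt b => .halt b

theorem exists_descends_gaussMachine {x : ℝ} (hx : x < 1) :
    ∃ d, gaussMachine.Descends x d := by
  obtain ⟨C, hC₀, hC⟩ := exists_nonneg_mul_one_sub_eq hx (by norm_num : (0 : ℝ) ≤ 18)
  let d : GaussState → ℝ
    | .start | .call _ | .secondCall _ => C
    | .query _ => C + 17
    | .secondQuery _ => C + 15
    | .toss _ => C + 13
    | .rewind _ | .advance _ => C + 12
    | .read _ => C + 11
    | .extend _ => C + 10
    | .append _ _ => C + 9
    | .compare _ _ => C + 8
    | .erase _ => C + 2
    | .lower _ => C + 1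
    | .halt _ => 0
  have h_nonneg : ∀ s, 0 ≤ d s := by
    rintro (_ | _ | _ | _ | _ | _ | _ | _ | _ | _ | _ | _ | _ | _ | _) <;> dsimp only [d] <;>
      linarith
  refine ⟨d, fun s => ⟨h_nonneg s, ?_⟩⟩
  rcases s with _ | k | k | k | k | k | p | p | p | ⟨p, r⟩ | ⟨p, r⟩ | p | p | p | -
  case toss =>
    cases k <;> simp only [Machine.action, gaussMachine, Instr.action, Option.elim_none,
      Option.elim_some, if_true, Bool.false_eq_true, if_false, d, mix] <;> linarith
  case read =>
    intro m
    change d ((m.str (0 : Fin 1)).read.elim (.extend p) (.compare p)) + 1 ≤ C + 11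
    cases (m.str (0 : Fin 1)).read <;>
      simp only [Option.elim_none, Option.elim_some, d] <;> linarith
  case compare =>
    cases r <;> simp only [Machine.action, gaussMachine, Instr.action, if_true, Bool.false_eq_true,
      Bool.true_eq_false, if_false, d, mix] <;> linarith
  all_goals simp only [Machine.action, gaussMachine, Instr.action, Bool.forall_bool, if_true,
    Bool.false_eq_true, if_false, d, mix]
  all_goals first
    | linarith
    | exact fun _ => by linarith
    | constructor <;> linarith

/-- The probability that an even number of the trials that follow a number `v` succeed, if `l` is
the rate of the machine: a run of `k` successes has probability `(l * v) ^ k / k!`. -/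
def decay (l v : ℝ) : ℝ := Real.exp (-(l * v))

theorem continuous_decay : Continuous decay.uncurry := by
  unfold decay Function.uncurry
  fun_prop

theorem decay_mem_Icc {l v : ℝ} (hl : 0 ≤ l) (hv : 0 ≤ v) : decay l v ∈ Set.Icc 0 1 :=
  ⟨(Real.exp_pos _).le, Real.exp_le_one_iff.2 (neg_nonpos.2 (mul_nonneg hl hv))⟩

theorem mul_integral_decay (l v : ℝ) : l * ∫ w in (0 : ℝ)..v, decay l w = 1 - decay l v := by
  have h_cont : Continuous fun w => l * decay l w :=
    continuous_const.mul (continuous_decay.comp (.prodMk_right l))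
  have h_deriv : ∀ w ∈ Set.uIcc 0 v,
      HasDerivAt (fun w => -decay l w) (l * decay l w) w := fun w _ =>
    (((hasDerivAt_id w).const_mul l).neg.exp.neg).congr_deriv (by simp [decay, mul_comm])
  rw [← intervalIntegral.integral_const_mul,
    intervalIntegral.integral_eq_sub_of_hasDerivAt h_deriv (h_cont.intervalIntegrable 0 v)]
  simp [decay, add_comm, sub_eq_add_neg]

theorem mul_compareMean_nil_decay (l : ℝ) (s : List Bool) :
    l * compareMean (decay l) [] s = 1 - dyadicMean (decay l) s := by
  have h_below : ∀ t, l * meanBelow (decay l) [] t = 1 - decay l t := fun t => by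
    rw [meanBelow, List.length_nil, pow_zero, one_mul]
    exact mul_integral_decay l t
  have h_cont : Continuous fun t => decay l (dyadicPoint s t) := by
    unfold decay
    fun_prop
  unfold compareMean
  rw [dyadicMean, ← intervalIntegral.integral_const_mul]
  simp only [h_below]
  rw [intervalIntegral.integral_sub intervalIntegrable_const (h_cont.intervalIntegrable 0 1)]
  simp [dyadicMean]

/-- The probability that the calls, the queries and the toss of a trial succeed. -/
def gaussRate (x u : ℝ) : ℝ := x * (x * (u * (u * (1 / 2))))

theorem gaussRate_nonneg {x u : ℝ} (hx : 0 ≤ x) (hu : 0 ≤ u) : 0 ≤ gaussRate x u := by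
  unfold gaussRate
  positivity

namespace GaussState

/-- The probability of output `1` after the calls, the queries and the toss of a trial have
succeeded, when the string starts with the word `w`. -/
def tossedValue (f : ℝ → ℝ) (w : List Bool) : Option Bool → ℝ
  | none => orient false (dyadicMean f w)
  | some p => orient (!p) (compareMean f [] w)

/-- The probability of output `1` if the string is `τ`, the bag holds `u`, and `f v` is the
probability that an even number of the trials that follow a number `v` succeed. -/
def value (x u : ℝ) (f : ℝ → ℝ) (τ : StringReg) : GaussState → ℝ
  | start => mix x (mix (gaussRate x u) (tossedValue f (τ.left ++ τ.right) none) (digit true))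
      (digit false)
  | call k => mix (gaussRate x u) (tossedValue f (τ.left ++ τ.right) k) (digit (k.getD true))
  | secondCall k => mix (x * (u * (u * (1 / 2)))) (tossedValue f (τ.left ++ τ.right) k)
      (digit (k.getD true))
  | query k => mix (u * (u * (1 / 2))) (tossedValue f (τ.left ++ τ.right) k) (digit (k.getD true))
  | secondQuery k => mix (u * (1 / 2)) (tossedValue f (τ.left ++ τ.right) k) (digit (k.getD true))
  | toss k => mix (1 / 2) (tossedValue f (τ.left ++ τ.right) k) (digit (k.getD true))
  | rewind p => tossedValue f (τ.left ++ τ.right) (some p)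
  | read p => orient (!p) (compareMean f τ.left (τ.left ++ τ.right))
  | extend p => mix (1 / 2)
      (orient (!p) (compareMean f τ.left (τ.left ++ true :: τ.right.tail)))
      (orient (!p) (compareMean f τ.left (τ.left ++ false :: τ.right.tail)))
  | append p r => orient (!p) (compareMean f τ.left (τ.left ++ r :: τ.right.tail))
  | compare p r => orient (!p) (mix (1 / 2)
      (compareMean f τ.advance.left (τ.advance.left ++ τ.advance.right))
      (if r then dyadicMean f (τ.left ++ [false]) else 0))
  | advance p => orient (!p) (compareMean f τ.advance.left (τ.advance.left ++ τ.advance.right))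
  | erase p => orient (!p) (dyadicMean f (τ.left ++ [false]))
  | lower p => orient (!p) (dyadicMean f (τ.left ++ false :: τ.right.tail))
  | halt b => digit b

theorem tossedValue_mem_Icc {f : ℝ → ℝ} (hf : ∀ v ∈ Set.Icc (0 : ℝ) 1, f v ∈ Set.Icc 0 1)
    (w : List Bool) (k : Option Bool) : tossedValue f w k ∈ Set.Icc 0 1 := by
  cases k with
  | none => exact orient_mem_Icc _ (dyadicMean_mem_Icc hf w)
  | some p => exact orient_mem_Icc _ (compareMean_append_mem_Icc hf [] w)

theorem value_mem_Icc {x u : ℝ} (hx : x ∈ Set.Icc 0 1) (hu : u ∈ Set.Icc 0 1) {f : ℝ → ℝ}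
    (hf : ∀ v ∈ Set.Icc (0 : ℝ) 1, f v ∈ Set.Icc 0 1) (τ : StringReg) (s : GaussState) :
    value x u f τ s ∈ Set.Icc 0 1 := by
  have h_half : (1 / 2 : ℝ) ∈ Set.Icc (0 : ℝ) 1 := by norm_num
  have h_query : u * (1 / 2) ∈ Set.Icc 0 1 := unitInterval.mul_mem hu h_half
  have h_queries : u * (u * (1 / 2)) ∈ Set.Icc 0 1 := unitInterval.mul_mem hu h_query
  have h_call : x * (u * (u * (1 / 2))) ∈ Set.Icc 0 1 := unitInterval.mul_mem hx h_queries
  have h_rate : gaussRate x u ∈ Set.Icc 0 1 := unitInterval.mul_mem hx h_call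
  have h_tossed := tossedValue_mem_Icc hf (τ.left ++ τ.right)
  have h_mean := fun p w => orient_mem_Icc p (dyadicMean_mem_Icc hf w)
  have h_compare := fun p s r => orient_mem_Icc p (compareMean_append_mem_Icc hf s r)
  rcases s with _ | k | k | k | k | k | p | p | p | ⟨p, r⟩ | ⟨p, r⟩ | p | p | p | b
  · exact mix_mem_Icc hx (mix_mem_Icc h_rate (h_tossed _) (digit_mem_Icc _)) (digit_mem_Icc _)
  · exact mix_mem_Icc h_rate (h_tossed k) (digit_mem_Icc _)
  · exact mix_mem_Icc h_call (h_tossed k) (digit_mem_Icc _)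
  · exact mix_mem_Icc h_queries (h_tossed k) (digit_mem_Icc _)
  · exact mix_mem_Icc h_query (h_tossed k) (digit_mem_Icc _)
  · exact mix_mem_Icc h_half (h_tossed k) (digit_mem_Icc _)
  · exact h_tossed (some p)
  · exact h_compare _ _ _
  · exact mix_mem_Icc h_half (h_compare _ _ _) (h_compare _ _ _)
  · exact h_compare _ _ _
  · refine orient_mem_Icc _ (mix_mem_Icc h_half (compareMean_append_mem_Icc hf _ _) ?_)
    cases r
    · exact digit_mem_Icc false
    · exact dyadicMean_mem_Icc hf _
  · exact h_compare _ _ _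
  · exact h_mean _ _
  · exact h_mean _ _
  · exact digit_mem_Icc b

theorem measurable_value {f : ℝ → ℝ → ℝ} (hf : Continuous f.uncurry) (x : ℝ) (τ : StringReg)
    (s : GaussState) : Measurable fun u => value x u (f u) τ s := by
  have h_mean := fun w => (continuous_dyadicMean hf w).measurable
  have h_compare := fun w w' => (continuous_compareMean hf w w').measurable
  have h_tossed : ∀ w k, Measurable fun u => tossedValue (f u) w k := by
    rintro w (_ | p) <;> exact measurable_orient _ (by fun_prop)
  cases s with
  | compare p r =>
    refine measurable_orient _ (measurable_mix measurable_const (h_compare _ _) ?_)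
    cases r
    · exact measurable_const
    · exact h_mean _
  | _ =>
    unfold value gaussRate
    fun_prop

theorem value_call_some (x u : ℝ) (τ : StringReg) (p : Bool) :
    value x u (decay (gaussRate x u)) τ (call (some p)) =
      orient p (dyadicMean (decay (gaussRate x u)) (τ.left ++ τ.right)) := by
  change mix (gaussRate x u) (orient (!p) _) (digit p) = _
  rw [orient_not, ← orient_one, mix_orient, mix,
    ← sub_sub_self 1 (dyadicMean (decay (gaussRate x u)) _), ← mul_compareMean_nil_decay]
  congr 1
  ring

theorem value_read_nil (x u : ℝ) {f : ℝ → ℝ} (hf : Continuous f) (l : List Bool) (p : Bool) :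
    value x u f ⟨l, []⟩ (read p) = value x u f ⟨l, []⟩ (extend p) := by
  simp only [value, mix_orient, List.append_nil, List.tail_nil]
  exact congrArg _ (dyadicMean_eq_mix (continuous_meanBelow_right hf l) l)

theorem value_read_cons (x u : ℝ) {f : ℝ → ℝ} (hf : Continuous f) (l w : List Bool) (p r : Bool) :
    value x u f ⟨l, r :: w⟩ (read p) = value x u f ⟨l, r :: w⟩ (compare p r) := by
  simp only [value, StringReg.advance, compareMean_cons hf l r w, List.append_assoc,
    List.singleton_append]

theorem value_read (x u : ℝ) {f : ℝ → ℝ} (hf : Continuous f) (τ : StringReg) (p : Bool) :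
    value x u f τ (read p) = value x u f τ (τ.read.elim (extend p) (compare p)) := by
  rcases τ with ⟨l, - | ⟨r, w⟩⟩
  · exact value_read_nil x u hf l p
  · exact value_read_cons x u hf l w p r

theorem value_compare (x u : ℝ) (f : ℝ → ℝ) (τ : StringReg) (p r : Bool) :
    value x u f τ (compare p r) =
      mix (1 / 2) (value x u f τ (if true = r then advance p else if r then erase p else halt p))
        (value x u f τ (if false = r then advance p else if r then erase p else halt p)) := by
  cases r
  · change orient (!p) (mix (1 / 2) _ 0) = mix (1 / 2) (digit p) (orient (!p) _)
    rw [← orient_one, ← sub_zero (1 : ℝ), ← orient_not, mix_orient]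
    unfold mix
    ring_nf
  · exact (mix_orient (!p) ..).symm

theorem integral_value_start (x : ℝ) :
    ∫ u in (0 : ℝ)..1, value x u (decay (gaussRate x u)) ⟨[], []⟩ start =
      ∫ w in (0 : ℝ)..x, Real.exp (-w ^ 2 / 2) := by
  have h_start : ∀ u, value x u (decay (gaussRate x u)) ⟨[], []⟩ start =
      x * Real.exp (-(x * u) ^ 2 / 2) := fun u => by
    have h_mean := mul_integral_decay (gaussRate x u) 1
    have h_exp : decay (gaussRate x u) 1 = Real.exp (-(x * u) ^ 2 / 2) := by
      unfold decay gaussRate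
      ring_nf
    change mix x (mix _ (1 - ∫ t in (0 : ℝ)..1, decay (gaussRate x u) t) 1) 0 = _
    rw [← h_exp]
    unfold mix
    linear_combination -x * h_mean
  simp only [h_start]
  rw [intervalIntegral.integral_const_mul,
    intervalIntegral.mul_integral_comp_mul_left (f := fun w => Real.exp (-w ^ 2 / 2)), mul_zero,
    mul_one]

end GaussState

theorem isValue_gaussMachine {x : NNReal} (hx : x ≤ 1) :
    gaussMachine.IsValue (0 : Fin 1) x fun s m u =>
      GaussState.value x u (decay (gaussRate x u)) (m.str (0 : Fin 1)) s where
  measurable s m := GaussState.measurable_value (by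
    unfold gaussRate decay Function.uncurry
    fun_prop) x _ s
  mem_Icc s m u hu := GaussState.value_mem_Icc ⟨x.coe_nonneg, by exact_mod_cast hx⟩ hu
    (fun _ hv => decay_mem_Icc (gaussRate_nonneg x.coe_nonneg hu.1) hv.1) _ s
  step := by
    intro s m u _
    have h_cont : Continuous (decay (gaussRate x u)) := continuous_decay.comp (.prodMk_right _)
    have h_update : ∀ (τ : StringReg) s,
        GaussState.value x u (decay (gaussRate x u))
          (Function.update m.str (0 : Fin 1) τ (0 : Fin 1)) s =
        GaussState.value x u (decay (gaussRate x u)) τ s := fun τ s => by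
      rw [Function.update_self]
    rcases s with _ | k | k | k | k | k | p | p | p | ⟨p, r⟩ | ⟨p, r⟩ | p | p | p | b
    · rfl
    · exact mix_mul ..
    · exact mix_mul ..
    · exact ⟨rfl, mix_mul ..⟩
    · exact ⟨rfl, mix_mul ..⟩
    · cases k with
      | none => exact congrArg (mix (1 / 2) · _) (GaussState.value_call_some ..).symm
      | some p => rfl
    · exact (h_update (m.str (0 : Fin 1)).rewind (.read p)).symm
    · exact GaussState.value_read _ _ h_cont _ p
    · rfl
    · refine .trans ?_ (h_update ((m.str (0 : Fin 1)).write r) (.compare p r)).symm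
      exact GaussState.value_read_cons _ _ h_cont _ _ p r
    · exact GaussState.value_compare ..
    · exact (h_update (m.str (0 : Fin 1)).advance (.read p)).symm
    · exact (h_update (m.str (0 : Fin 1)).erase (.lower p)).symm
    · refine .trans ?_ (h_update ((m.str (0 : Fin 1)).write false) (.call (some !p))).symm
      exact (GaussState.value_call_some x u ((m.str (0 : Fin 1)).write false) !p).symm
    · rfl

theorem stronglyRealizable_gauss :
    StronglyRealizable stringAndBag fun x => ∫ w in (0 : ℝ)..x, Real.exp (-w ^ 2 / 2) :=
  stronglyRealizable_of_isValue gaussMachine (0 : Fin 1)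
    (fun _ hx => exists_descends_gaussMachine (by exact_mod_cast hx)) fun _ hx =>
      ⟨_, isValue_gaussMachine hx.le, GaussState.integral_value_start _⟩

end Buffon

end

theorem theorem7 :
    Buffon.StronglyRealizable { numCounters := 0, numStacks := 0, numStrings := 0, numBags := 1 }
      (fun x => Real.log (1 + x)) ∧
    Buffon.StronglyRealizable { numCounters := 0, numStacks := 0, numStrings := 0, numBags := 1 }
      (fun x => Real.arctan x) ∧
    Buffon.StronglyRealizable { numCounters := 0, numStacks := 1, numStrings := 0, numBags := 1 }
      (fun x => 1 / 2 * Real.arcsin x) ∧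
    Buffon.StronglyRealizable { numCounters := 0, numStacks := 0, numStrings := 1, numBags := 1 }
      (fun x => ∫ w in (0 : ℝ)..x, Real.exp (-w ^ 2 / 2)) :=
  ⟨Buffon.stronglyRealizable_log, Buffon.stronglyRealizable_arctan,
    Buffon.stronglyRealizable_half_arcsin, Buffon.stronglyRealizable_gauss⟩
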